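/- **Setting.** There are $n\ge 1$ players $N=\{1,\dots,n\}$ and a single good. Player $i$'s value $v_i\ge 0$ is drawn independently from a distribution $\mathcal D_i$ on $[0,\infty)$ with finite mean; $\mathcal D=\mathcal D_1\times\dots\times\mathcal D_n$. All value distributions considered (also reported ones) are Borel probability measures on $[0,\infty)$ with finite mean. Utilities are quasi-linear. The knowledge graph $G$ is a directed graph on $N$; player $i$ knows $\mathcal D_j$ iff $(i,j)\in G$. $G$ is *2-connected* if it is strongly connected and remains strongly connected after removing any single node with its adjacent edges. A crowdsourced mechanism gets from each player $i$ a value $b_i$ and a knowledge $K_i=(\mathcal D^i_j)_{j\ne i}$, where each $\mathcal D^i_j$ is a distribution or the symbol $\bot$; the true knowledge of $i$ has $\mathcal D^i_j=\mathcal D_j$ if $(i,j)\in G$ and $\mathcal D^i_j=\bot$ otherwise. Such a mechanism is *2-DST* if, with $u_i$ the utility in expectation over the mechanism's coins, 1. for every player $i$, true value $v_i$, value $b_i$, knowledge $K_i$ and strategies $s_{-i}$ of the others, $u_i((v_i,K_i),s_{-i})\ge u_i((b_i,K_i),s_{-i})$; 2. for every player $i$, true value $v_i$, true knowledge $K_i$,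 knowledge $K_i'$, and functions $K'_j(\cdot)$ of the other players' values (such that the utilities below are measurable in $v_{-i}$), the following expectations exist and $$\mathbb E_{v_{-i}\sim\mathcal D_{-i}}u_i((v_i,K_i),(v_{-i},K'_{-i}(v_{-i})))\ge \mathbb E_{v_{-i}\sim\mathcal D_{-i}}u_i((v_i,K'_i),(v_{-i},K'_{-i}(v_{-i}))).$$ $OPT(\mathcal D)$ is the supremum of the expected revenue $\mathbb E_{v\sim \mathcal D}\sum_i p_i(v)$ over all (randomized) Bayesian mechanisms for the single good that are Bayesian incentive compatible and interim individually rational (types ranging over the supports of the $\mathcal D_i$). For a distribution $F$, let $\phi(\cdot;F)$ be its ironed virtual value: the slope (right derivative) at the quantile $\Pr_{x\sim F}[x>v]$ of the concave hull of the revenue curve of $F$ in quantile space; it is $-\infty$ for $v$ with $\Pr_{x\sim F}[x>v]=1$. **The crowdsourced Myerson mechanism $\mathcal M_{CSM}$.** Each player reports $(b_i,K_i)$. Choose a player $a$ uniformly at random; let $S=\{j\ne a: \mathcal D^a_j\ne\bot\}$, $N'=N\setminus(\{a\}\cup S)$ and $\mathcal D'_j=\mathcal D^a_j$ for $j\in S$.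 If $S=\emptyset$, the good is unsold and all prices are $0$. Otherwise let $i^*=\arg\max_{j\in S}\phi(b_j;\mathcal D'_j)$, ties broken lexicographically. While $N'\neq\emptyset$: let $S'$ be the set of $j\in N'$ such that $\mathcal D^{i'}_j\ne\bot$ for some $i'\in S\setminus\{i^*\}$; if $S'=\emptyset$ leave the loop; for $j\in S'$ set $\mathcal D'_j=\mathcal D^{i'}_j$ for the first such $i'$; replace $S$ by $\{i^*\}\cup S'$ and $N'$ by $N'\setminus S'$; and let again $i^*=\arg\max_{j\in S}\phi(b_j;\mathcal D'_j)$, ties broken lexicographically. After the loop let $\phi_{second}$ be the maximum of $\phi(b_j;\mathcal D'_j)$ over $j\in N\setminus(\{a,i^*\}\cup N')$ ($-\infty$ if there is no such $j$). If $\phi(b_{i^*};\mathcal D'_{i^*})<0$ the good is unsold and all prices are $0$. Otherwise it is sold to $i^*$, whose price is the threshold $\phi^{-1}(\max\{\phi_{second},0\};\mathcal D'_{i^*})$, i.e. the infimum of the values $x\ge0$ with $\phi(x;\mathcal D'_{i^*})\ge\max\{\phi_{second},0\}$ for which, in case of equality with $\phi_{second}$, the lexicographic tie-breaking favours $i^*$;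 all other prices are $0$. **Theorem.** For every such $n$ and $\mathcal D$ and every 2-connected knowledge graph $G$, $\mathcal M_{CSM}$ is 2-DST, and under truthful reports of values and knowledge its revenue is integrable and $$\mathbb E_{v\sim\mathcal D}\,Rev(\mathcal M_{CSM})\ \ge\ \Bigl(1-\frac1n\Bigr)\,OPT(\mathcal D).$$ -/

import Mathlib

open MeasureTheory
open scoped NNReal

noncomputable section

namespace CrowdAuction

/-! ### Value distributions and ironed virtual values -/

/-- A value distribution: a Borel probability measure on `[0, ∞)` with finite expectation.
It may be discrete, continuous or mixed, regular or not, with bounded or unbounded support. -/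
structure ValueDist where
  law : Measure ℝ≥0
  isProb : IsProbabilityMeasure law
  finiteMean : Integrable (fun x : ℝ≥0 => (x : ℝ)) law

attribute [instance] ValueDist.isProb

/-- The pairs (probability of sale, expected revenue) reached by the posted prices `p ≥ 0`,
together with `(0, 0)`, which stands for never selling. -/
def ValueDist.revenuePoints (d : ValueDist) : Set (ℝ × ℝ) :=
  insert (0, 0) (Set.range fun p : ℝ≥0 =>
    (d.law.real (Set.Ici p), (p : ℝ) * d.law.real (Set.Ici p)))

/-- The ironed revenue curve in quantile space: the upper boundary of the convex hull of the
revenue points, that is, the concave hull of the revenue curve. -/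
def ValueDist.ironedRevenue (d : ValueDist) (q : ℝ) : ℝ :=
  sSup {r : ℝ | (q, r) ∈ convexHull ℝ d.revenuePoints}

/-- The ironed virtual value `φ(v; d)`: the right derivative of the ironed revenue curve at the
quantile `Pr[V > v]`. The curve is concave, so this is the supremum of its difference quotients
to the right. For a regular distribution with density `f` it is `v - (1 - F v) / f v`; for an atom
it is the slope on the quantile interval of the atom. It is `⊥` (that is, `-∞`) when `v` lies below
the whole support. -/
def ValueDist.virtualValue (d : ValueDist) (v : ℝ≥0) : EReal :=
  ⨆ q ∈ Set.Ioc (d.law.real (Set.Ioi v)) 1,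
    (((d.ironedRevenue q - d.ironedRevenue (d.law.real (Set.Ioi v))) /
      (q - d.law.real (Set.Ioi v)) : ℝ) : EReal)

/-! ### Knowledge graphs -/

/-- There is a directed path from any node to any other node. -/
def StronglyConnected {V : Type*} (G : Digraph V) : Prop :=
  ∀ i j : V, Relation.ReflTransGen G.Adj i j

/-- The graph with the node `k` and all its adjacent edges removed. -/
def removeNode {V : Type*} (G : Digraph V) (k : V) : Digraph {j : V // j ≠ k} where
  Adj x y := G.Adj x.1 y.1

/-- The graph is strongly connected, and remains so after removing any single node. -/
def TwoConnected {V : Type*} (G : Digraph V) : Prop :=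
  StronglyConnected G ∧ ∀ k : V, StronglyConnected (removeNode G k)

/-! ### Crowdsourced mechanisms -/

/-- A knowledge about the players: for each player a distribution, or `none` for `⊥`.
In a player's report the entry at his own index carries no meaning. -/
abbrev Knowledge (n : ℕ) := Fin n → Option ValueDist

/-- What a player reports: a value and a knowledge. -/
structure Report (n : ℕ) where
  value : ℝ≥0
  knowledge : Knowledge n

/-- An outcome of a single-good auction: who gets the item, if anybody, and the prices. -/
structure Outcome (n : ℕ) where
  winner : Option (Fin n)
  price : Fin n → ℝ

/-- Quasi-linear utility of player `i` with true value `v`. -/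
def Outcome.utility {n : ℕ} (o : Outcome n) (i : Fin n) (v : ℝ≥0) : ℝ :=
  (if o.winner = some i then (v : ℝ) else 0) - o.price i

/-- A (randomized) crowdsourced single-good mechanism: a finite probability space of coins, and
an outcome for each coin and each profile of reports. It sees neither the prior nor the graph. -/
structure Mechanism (n : ℕ) where
  Coin : Type
  [fintypeCoin : Fintype Coin]
  coinLaw : PMF Coin
  outcome : Coin → (Fin n → Report n) → Outcome n

attribute [instance] Mechanism.fintypeCoin

/-- Utility of player `i` with true value `v` under the reports `s`, in expectation over the
coins of the mechanism. -/
def Mechanism.utility {n : ℕ} (M : Mechanism n) (i : Fin n) (v : ℝ≥0)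
    (s : Fin n → Report n) : ℝ :=
  ∑ c, (M.coinLaw c).toReal * (M.outcome c s).utility i v

/-- Revenue under the reports `s`, in expectation over the coins of the mechanism. -/
def Mechanism.revenue {n : ℕ} (M : Mechanism n) (s : Fin n → Report n) : ℝ :=
  ∑ c, (M.coinLaw c).toReal * ∑ i, (M.outcome c s).price i

/-- The joint prior of the players' independent values. -/
def prior {n : ℕ} (D : Fin n → ValueDist) : Measure (Fin n → ℝ≥0) :=
  Measure.pi fun i => (D i).law

open Classical in
/-- The true knowledge of player `i`: he knows the distributions of his out-neighbours. -/
def trueKnowledge {n : ℕ} (D : Fin n → ValueDist) (G : Digraph (Fin n)) (i : Fin n) :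
    Knowledge n :=
  fun j => if G.Adj i j then some (D j) else none

/-- The reports in which everybody tells his true value and his true knowledge. -/
def truthful {n : ℕ} (D : Fin n → ValueDist) (G : Digraph (Fin n)) (v : Fin n → ℝ≥0) :
    Fin n → Report n :=
  fun i => ⟨v i, trueKnowledge D G i⟩

/-- The reports in which player `i` reports his true value `x` and the knowledge `K`, and each
other player `j` reports his true value `v j` and the knowledge `σ j (v j)`. -/
def knowledgeProfile {n : ℕ} (i : Fin n) (x : ℝ≥0) (K : Knowledge n)
    (σ : Fin n → ℝ≥0 → Knowledge n) (v : Fin n → ℝ≥0) : Fin n → Report n :=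
  fun j => if j = i then ⟨x, K⟩ else ⟨v j, σ j (v j)⟩

/-- First requirement: reporting the true value is dominant, whatever knowledge is reported and
whatever the others do. -/
def ValueTruthful {n : ℕ} (M : Mechanism n) : Prop :=
  ∀ (i : Fin n) (v b : ℝ≥0) (K : Knowledge n) (s : Fin n → Report n),
    M.utility i v (Function.update s i ⟨b, K⟩) ≤ M.utility i v (Function.update s i ⟨v, K⟩)

/-- Second requirement: when all players report their true values, reporting the true knowledge is
dominant in expectation over the values of the others. The knowledge reported by another player may
depend on his value in any way that makes the utilities measurable, so that one can speak of their
expectations; that these expectations exist is part of the requirement. The integrands do not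
depend on the coordinate `v i`, so integrating over the whole prior is integrating over the
values of the others. -/
def KnowledgeTruthful {n : ℕ} (M : Mechanism n) (D : Fin n → ValueDist)
    (G : Digraph (Fin n)) : Prop :=
  ∀ (i : Fin n) (x : ℝ≥0) (K : Knowledge n) (σ : Fin n → ℝ≥0 → Knowledge n),
    AEStronglyMeasurable
      (fun v => M.utility i x (knowledgeProfile i x (trueKnowledge D G i) σ v)) (prior D) →
    AEStronglyMeasurable (fun v => M.utility i x (knowledgeProfile i x K σ v)) (prior D) →
    Integrable
      (fun v => M.utility i x (knowledgeProfile i x (trueKnowledge D G i) σ v)) (prior D) ∧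
    Integrable (fun v => M.utility i x (knowledgeProfile i x K σ v)) (prior D) ∧
    ∫ v, M.utility i x (knowledgeProfile i x K σ v) ∂(prior D) ≤
      ∫ v, M.utility i x (knowledgeProfile i x (trueKnowledge D G i) σ v) ∂(prior D)

/-- 2-step dominant strategy truthfulness on the instance with prior `D` and graph `G`. -/
def TwoDST {n : ℕ} (M : Mechanism n) (D : Fin n → ValueDist) (G : Digraph (Fin n)) : Prop :=
  ValueTruthful M ∧ KnowledgeTruthful M D G

/-! ### The crowdsourced Myerson mechanism -/

/-- The players of `S` with the highest score. -/
def leaders {n : ℕ} (w : Fin n → EReal) (S : Finset (Fin n)) : Finset (Fin n) :=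
  S.filter fun j => ∀ k ∈ S, w k ≤ w j

theorem leaders_nonempty {n : ℕ} (w : Fin n → EReal) {S : Finset (Fin n)} (h : S.Nonempty) :
    (leaders w S).Nonempty := by
  obtain ⟨j, hj, hmax⟩ := S.exists_max_image w h
  exact ⟨j, Finset.mem_filter.2 ⟨hj, hmax⟩⟩

/-- The player of `S` with the highest score, ties broken lexicographically. -/
def top {n : ℕ} (w : Fin n → EReal) (S : Finset (Fin n)) (h : S.Nonempty) : Fin n :=
  (leaders w S).min' (leaders_nonempty w h)

/-- The virtual value of player `j`'s report under the distribution collected for him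
(`⊥` if there is none, which is never relevant). -/
def score {n : ℕ} (s : Fin n → Report n) (D' : Knowledge n) (j : Fin n) : EReal :=
  match D' j with
  | none => ⊥
  | some d => d.virtualValue (s j).value

/-- The variables of the mechanism: the current set `S`, the set `N'` of players whose
distributions have not been collected, the current `i*`, and the collected distributions. -/
structure State (n : ℕ) where
  S : Finset (Fin n)
  rest : Finset (Fin n)
  star : Fin n
  D' : Knowledge n

/-- The distribution of `j` reported by the first player of `S \ {i*}` who reports one. -/
def firstReport {n : ℕ} (s : Fin n → Report n) (σ : State n) (j : Fin n) : Option ValueDist :=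
  (List.finRange n).findSome? fun i => if i ∈ σ.S.erase σ.star then (s i).knowledge j else none

/-- The set `S'`: players of `N'` whose distributions are reported by somebody in `S \ {i*}`. -/
def discovered {n : ℕ} (s : Fin n → Report n) (σ : State n) : Finset (Fin n) :=
  σ.rest.filter fun j => ∃ i ∈ σ.S.erase σ.star, ((s i).knowledge j).isSome = true

/-- The body of the loop, for nonempty `S'`. -/
def next {n : ℕ} (s : Fin n → Report n) (σ : State n) : State n :=
  let S' := discovered s σ
  let D' : Knowledge n := fun j => if j ∈ S' then firstReport s σ j else σ.D' j
  { S := insert σ.star S'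
    rest := σ.rest \ S'
    star := top (score s D') (insert σ.star S') (Finset.insert_nonempty _ _)
    D' := D' }

/-- The loop: it stops when `S'` is empty, in particular when `N'` is empty. -/
def collect {n : ℕ} (s : Fin n → Report n) (σ : State n) : State n :=
  if (discovered s σ).Nonempty then collect s (next s σ) else σ
termination_by σ.rest.card
decreasing_by
  rename_i h
  apply Finset.card_lt_card
  refine Finset.ssubset_iff_subset_ne.2 ⟨Finset.sdiff_subset, fun heq => ?_⟩
  obtain ⟨j, hj⟩ := h
  have hr : j ∈ σ.rest := (Finset.mem_filter.1 hj).1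
  have hj' : j ∈ σ.rest \ discovered s σ := by
    change j ∈ (next s σ).rest
    rw [show (next s σ).rest = σ.rest from heq]
    exact hr
  exact (Finset.mem_sdiff.1 hj').2 hj

/-- The players compared with `i*` at the end: all but `a`, `i*` and the players left in `N'`. -/
def rivals {n : ℕ} (a : Fin n) (σ : State n) : Finset (Fin n) :=
  Finset.univ \ ({a, σ.star} ∪ σ.rest)

/-- The value `φ⁻¹(max {φ_second, 0})` of `i*`, as the threshold payment: the infimum of the values
at which the virtual value of `i*` is at least `max {φ_second, 0}` and, in case it equals
`φ_second`, the tie is broken in favour of `i*`. (Where the virtual value is strictly increasing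
this is the inverse; on the flat pieces created by ironing or atoms it is the threshold.) -/
def thresholdPrice {n : ℕ} (s : Fin n → Report n) (a : Fin n) (σ : State n)
    (d : ValueDist) : ℝ≥0 :=
  let second : EReal := (rivals a σ).sup (score s σ.D')
  sInf {x : ℝ≥0 | max second 0 ≤ d.virtualValue x ∧
    (d.virtualValue x = second → ∀ j ∈ rivals a σ, score s σ.D' j = second → σ.star < j)}

/-- The last two steps: allocation and price. -/
def finish {n : ℕ} (s : Fin n → Report n) (a : Fin n) (σ : State n) : Outcome n :=
  match σ.D' σ.star with
  | none => ⟨none, 0⟩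
  | some d =>
    if d.virtualValue (s σ.star).value < 0 then ⟨none, 0⟩
    else ⟨some σ.star, Pi.single σ.star ((thresholdPrice s a σ d : ℝ≥0) : ℝ)⟩

/-- The distributions reported by the excluded player `a`. -/
def initialDist {n : ℕ} (s : Fin n → Report n) (a : Fin n) : Knowledge n :=
  fun j => if j = a then none else (s a).knowledge j

/-- The players whose distributions are reported by the excluded player `a`. -/
def initialSet {n : ℕ} (s : Fin n → Report n) (a : Fin n) : Finset (Fin n) :=
  Finset.univ.filter fun j => (initialDist s a j).isSome = true

/-- The outcome of the crowdsourced Myerson mechanism when the excluded player is `a`. -/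
def csmOutcome {n : ℕ} (a : Fin n) (s : Fin n → Report n) : Outcome n :=
  if h : (initialSet s a).Nonempty then
    finish s a (collect s
      { S := initialSet s a
        rest := Finset.univ \ ({a} ∪ initialSet s a)
        star := top (score s (initialDist s a)) (initialSet s a) h
        D' := initialDist s a })
  else ⟨none, 0⟩

/-- The crowdsourced Myerson mechanism: the excluded player is uniformly random. -/
def csm (n : ℕ) [NeZero n] : Mechanism n where
  Coin := Fin n
  coinLaw := PMF.uniformOfFintype (Fin n)
  outcome := csmOutcome

/-! ### The optimal Bayesian revenue -/

/-- A Bayesian single-good mechanism (randomized; described by the allocation probabilities and the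
expected prices for each profile of reported values). It may be built from the prior. -/
structure BayesianMechanism (n : ℕ) where
  alloc : (Fin n → ℝ≥0) → Fin n → ℝ
  pay : (Fin n → ℝ≥0) → Fin n → ℝ
  measurable_alloc : Measurable alloc
  measurable_pay : Measurable pay
  alloc_nonneg : ∀ v i, 0 ≤ alloc v i
  alloc_sum_le_one : ∀ v, ∑ i, alloc v i ≤ 1

/-- Interim expected utility of player `i` with true value `x` who reports `b`, the others
reporting their true values. -/
def BayesianMechanism.interimUtility {n : ℕ} (M : BayesianMechanism n) (D : Fin n → ValueDist)
    (i : Fin n) (x b : ℝ≥0) : ℝ :=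
  ∫ v, ((x : ℝ) * M.alloc (Function.update v i b) i - M.pay (Function.update v i b) i) ∂(prior D)

/-- The expected payments that enter the incentives and the revenue exist. -/
def BayesianMechanism.HasExpectations {n : ℕ} (M : BayesianMechanism n)
    (D : Fin n → ValueDist) : Prop :=
  ∀ i, Integrable (fun v => M.pay v i) (prior D) ∧
    ∀ b ∈ (D i).law.support, Integrable (fun v => M.pay (Function.update v i b) i) (prior D)

/-- Truth-telling is a Bayesian Nash equilibrium; the types of a player are the values in the
support of his distribution. -/
def BayesianMechanism.IsBIC {n : ℕ} (M : BayesianMechanism n) (D : Fin n → ValueDist) : Prop :=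
  ∀ i, ∀ x ∈ (D i).law.support, ∀ b ∈ (D i).law.support,
    M.interimUtility D i x b ≤ M.interimUtility D i x x

/-- Interim individual rationality. -/
def BayesianMechanism.IsIR {n : ℕ} (M : BayesianMechanism n) (D : Fin n → ValueDist) : Prop :=
  ∀ i, ∀ x ∈ (D i).law.support, 0 ≤ M.interimUtility D i x x

/-- Expected revenue under truthful reports. -/
def BayesianMechanism.revenue {n : ℕ} (M : BayesianMechanism n) (D : Fin n → ValueDist) : ℝ :=
  ∫ v, ∑ i, M.pay v i ∂(prior D)

/-- The optimal expected revenue among the individually rational BIC Bayesian mechanisms. -/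
def OPT {n : ℕ} (D : Fin n → ValueDist) : EReal :=
  ⨆ (M : BayesianMechanism n) (_ : M.HasExpectations D ∧ M.IsBIC D ∧ M.IsIR D),
    ((M.revenue D : ℝ) : EReal)

end CrowdAuction

end

/-! Truthfulness. A player's report can steer the search only while he is collected and not in
front, and a collected player who is not in front never gets in front again. So a run that ends with
`i` in front does not depend on the report of `i`, apart from the fact that it puts him in front
(`collect_startState_eq`). Hence a winner faces a threshold fixed by the others (`exists_winsWith`):
reporting the true value is dominant as in a second-price auction, and the knowledge a player
reports does not change his own utility at all.

Revenue. On a 2-connected graph a truthful run collects every distribution except that of `a`: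
removing the current `i*` leaves a strongly connected graph, so some edge leads from a collected
player (or `a`) to an uncollected one, and the loop cannot have stopped (`rest_finalState`). The
outcome is then the optimal auction without `a` (`price_truthful`).

Virtual values of arbitrary distributions are handled through the optimal profit H(c) = sup (p - c)
Pr[V ≥ p] of a seller with cost c. The virtual value at v exceeds c iff prices above v stay away
from H(c) (`lt_virtualValue_iff`), so the lowest value with virtual value above c, or at least c, is
an optimal price (`maxProfit_eq_of_lt`, `maxProfit_eq_of_le`). Comparing increments in c gives H(c)
= E(φ⁺ - c)⁺ for c ≥ 0 (`maxProfit_eq_excess`). It follows that a posted price earns at most the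
virtual surplus of the values served (`mul_real_le_setIntegral_posVV`), with equality at thresholds
of φ (`sInf_winSet_mul`).

The inequality, applied to the layers of a monotone interim allocation, bounds `OPT` by the expected
largest positive virtual value (`OPT_le`); the equality shows that the mechanism earns this quantity
with `a` left out. A random `a` is the maximizer with probability only 1/n (`mul_surplus_le`). -/

open Filter Topology

noncomputable section

namespace CrowdAuction

/-! ### Posted prices -/

/-! ### Continuity of sale probabilities along monotone sequences of prices. -/

section Limits

variable (μ : Measure ℝ≥0) [IsFiniteMeasure μ]

theorem tendsto_real_iUnion {A : ℕ → Set ℝ≥0} (h : Monotone A) :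
    Tendsto (fun n => μ.real (A n)) atTop (𝓝 (μ.real (⋃ n, A n))) :=
  (ENNReal.tendsto_toReal (measure_ne_top _ _)).comp (tendsto_measure_iUnion_atTop h)

theorem tendsto_real_iInter {A : ℕ → Set ℝ≥0} (h : Antitone A) (hA : ∀ n, MeasurableSet (A n)) :
    Tendsto (fun n => μ.real (A n)) atTop (𝓝 (μ.real (⋂ n, A n))) :=
  (ENNReal.tendsto_toReal (measure_ne_top _ _)).comp
    (tendsto_measure_iInter_atTop (fun n => (hA n).nullMeasurableSet) h ⟨0, measure_ne_top _ _⟩)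

/-- A sequence decreasing strictly to zero. -/
def invSucc (n : ℕ) : ℝ≥0 := ((n : ℝ≥0) + 1)⁻¹

theorem invSucc_pos (n : ℕ) : 0 < invSucc n := by unfold invSucc; positivity

theorem invSucc_antitone : Antitone invSucc := by
  intro m n h
  unfold invSucc
  gcongr

theorem tendsto_invSucc : Tendsto (fun n => (invSucc n : ℝ)) atTop (𝓝 0) := by
  have := tendsto_one_div_add_atTop_nhds_zero_nat (𝕜 := ℝ)
  simpa [invSucc] using this

theorem exists_invSucc_lt {x : ℝ≥0} (hx : 0 < x) : ∃ n, invSucc n < x := by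
  have := (tendsto_invSucc.eventually (gt_mem_nhds (NNReal.coe_pos.2 hx))).exists
  exact_mod_cast this

theorem tendsto_real_Ici_add_invSucc (v : ℝ≥0) :
    Tendsto (fun n => μ.real (Set.Ici (v + invSucc n))) atTop (𝓝 (μ.real (Set.Ioi v))) := by
  have h : (⋃ n, Set.Ici (v + invSucc n)) = Set.Ioi v := by
    ext x
    simp only [Set.mem_iUnion, Set.mem_Ici, Set.mem_Ioi]
    constructor
    · rintro ⟨n, hn⟩
      exact lt_of_lt_of_le (lt_add_of_pos_right v (invSucc_pos n)) hn
    · intro hx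
      obtain ⟨n, hn⟩ := exists_invSucc_lt (tsub_pos_of_lt hx)
      exact ⟨n, by rw [add_comm]; exact (add_le_of_le_tsub_right_of_le hx.le hn.le)⟩
  rw [← h]
  refine tendsto_real_iUnion μ fun m n hmn => Set.Ici_subset_Ici.2 ?_
  gcongr
  exact invSucc_antitone hmn

theorem tendsto_real_Ici_sub_invSucc (v : ℝ≥0) :
    Tendsto (fun n => μ.real (Set.Ici (v - invSucc n))) atTop (𝓝 (μ.real (Set.Ici v))) := by
  have h : (⋂ n, Set.Ici (v - invSucc n)) = Set.Ici v := by
    ext x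
    simp only [Set.mem_iInter, Set.mem_Ici]
    constructor
    · intro hx
      by_contra! hlt
      obtain ⟨n, hn⟩ := exists_invSucc_lt (tsub_pos_of_lt hlt)
      have := tsub_le_iff_right.1 (hx n)
      have h2 := lt_tsub_iff_left.1 hn
      exact absurd this (not_le.2 h2)
    · intro hx n
      exact tsub_le_self.trans hx
  rw [← h]
  refine tendsto_real_iInter μ (fun m n hmn => Set.Ici_subset_Ici.2 ?_) fun n => measurableSet_Ici
  exact tsub_le_tsub_left (invSucc_antitone hmn) v

end Limits

/-- An up-set of values is a ray from its infimum. -/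
theorem upperSet_eq_ray {A : Set ℝ≥0} (hA : IsUpperSet A) (hne : A.Nonempty) :
    A = Set.Ici (sInf A) ∨ A = Set.Ioi (sInf A) := by
  have hb : BddBelow A := OrderBot.bddBelow A
  have hgt : ∀ x, sInf A < x → x ∈ A := fun x hx => by
    obtain ⟨y, hy, hyx⟩ := (csInf_lt_iff hb hne).1 hx
    exact hA hyx.le hy
  by_cases hm : sInf A ∈ A
  · left
    exact Set.Subset.antisymm (fun x hx => csInf_le hb hx) fun x hx => hA hx hm
  · right
    refine Set.Subset.antisymm (fun x hx => lt_of_le_of_ne (csInf_le hb hx) ?_) hgt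
    rintro rfl
    exact hm hx

theorem measurableSet_of_isUpperSet {A : Set ℝ≥0} (hA : IsUpperSet A) : MeasurableSet A := by
  rcases A.eq_empty_or_nonempty with rfl | hne
  · exact MeasurableSet.empty
  · rcases upperSet_eq_ray hA hne with h | h <;> rw [h]
    exacts [measurableSet_Ici, measurableSet_Ioi]

/-! ### The optimal posted-price profit of a seller with a cost. -/

namespace ValueDist

variable (d : ValueDist)

/-- The expected value contributed by the values at least `p`. -/
def tail (p : ℝ≥0) : ℝ := ∫ x in Set.Ici p, (x : ℝ) ∂d.law

theorem tail_antitone : Antitone d.tail := fun _ _ h =>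
  setIntegral_mono_set d.finiteMean.integrableOn (Eventually.of_forall fun x => x.2)
    (Set.Ici_subset_Ici.2 h).eventuallyLE

theorem mul_sale_le_tail (p : ℝ≥0) : (p : ℝ) * d.law.real (Set.Ici p) ≤ d.tail p := by
  have h : ∫ _x in Set.Ici p, (p : ℝ) ∂d.law ≤ d.tail p :=
    setIntegral_mono_on (integrable_const _).integrableOn d.finiteMean.integrableOn
      measurableSet_Ici fun x hx => NNReal.coe_le_coe.2 hx
  rw [setIntegral_const, smul_eq_mul, mul_comm] at h
  exact h

theorem tendsto_tail : Tendsto (fun n : ℕ => d.tail n) atTop (𝓝 0) := by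
  have h := tendsto_setIntegral_of_antitone (μ := d.law) (f := fun x : ℝ≥0 => (x : ℝ))
    (s := fun n : ℕ => Set.Ici (n : ℝ≥0)) (fun n => measurableSet_Ici)
    (fun m n h => Set.Ici_subset_Ici.2 (by exact_mod_cast h)) ⟨0, d.finiteMean.integrableOn⟩
  have he : (⋂ n : ℕ, Set.Ici (n : ℝ≥0)) = ∅ := by
    refine Set.eq_empty_of_forall_notMem fun x hx => ?_
    obtain ⟨n, hn⟩ := exists_nat_gt x
    exact absurd (Set.mem_iInter.1 hx n) (not_le.2 hn)
  rwa [he, setIntegral_empty] at h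

/-- The expected revenue of the price `p` when selling costs `c`. -/
def profit (c : ℝ) (p : ℝ≥0) : ℝ := ((p : ℝ) - c) * d.law.real (Set.Ici p)

/-- The best expected profit from posting a price, or from not selling, at cost `c`. -/
def maxProfit (c : ℝ) : ℝ := sSup (insert 0 (Set.range (d.profit c)))

theorem profit_le_bound (c : ℝ) (p : ℝ≥0) : d.profit c p ≤ d.tail p + |c| := by
  have h1 := d.mul_sale_le_tail p
  have h2 : -c * d.law.real (Set.Ici p) ≤ |c| * 1 :=
    mul_le_mul (neg_le_abs c) measureReal_le_one measureReal_nonneg (abs_nonneg c)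
  unfold profit
  linarith

theorem bddAbove_profits (c : ℝ) : BddAbove (insert 0 (Set.range (d.profit c))) := by
  refine ⟨d.tail 0 + |c|, ?_⟩
  have h0 : 0 ≤ d.tail 0 := integral_nonneg fun x => x.2
  rintro _ (rfl | ⟨p, rfl⟩)
  · positivity
  · exact (d.profit_le_bound c p).trans (by gcongr; exact d.tail_antitone (zero_le))

theorem profit_le_maxProfit (c : ℝ) (p : ℝ≥0) : d.profit c p ≤ d.maxProfit c :=
  le_csSup (d.bddAbove_profits c) (Or.inr ⟨p, rfl⟩)

theorem maxProfit_nonneg (c : ℝ) : 0 ≤ d.maxProfit c :=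
  le_csSup (d.bddAbove_profits c) (Or.inl rfl)

theorem maxProfit_le {c h : ℝ} (h0 : 0 ≤ h) (hp : ∀ p, d.profit c p ≤ h) : d.maxProfit c ≤ h := by
  refine csSup_le (Set.insert_nonempty _ _) ?_
  rintro _ (rfl | ⟨p, rfl⟩)
  exacts [h0, hp p]

theorem exists_profit_gt {c h : ℝ} (h0 : 0 ≤ h) (hh : h < d.maxProfit c) :
    ∃ p, h < d.profit c p := by
  by_contra! hcon
  exact absurd (d.maxProfit_le h0 hcon) (not_le.2 hh)

theorem profit_antitone_cost (p : ℝ≥0) : Antitone fun c => d.profit c p := fun c _ h => by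
  unfold profit
  have : 0 ≤ d.law.real (Set.Ici p) := measureReal_nonneg
  dsimp only
  gcongr

theorem maxProfit_antitone : Antitone d.maxProfit := fun c _ h =>
  d.maxProfit_le (d.maxProfit_nonneg c) fun p =>
    (d.profit_antitone_cost p h).trans (d.profit_le_maxProfit c p)

/-- The profit just above the price `v` is a limit of profits. -/
theorem tendsto_profit_right (c : ℝ) (v : ℝ≥0) :
    Tendsto (fun n => d.profit c (v + invSucc n)) atTop
      (𝓝 (((v : ℝ) - c) * d.law.real (Set.Ioi v))) := by
  unfold profit
  refine Tendsto.mul ?_ (tendsto_real_Ici_add_invSucc d.law v)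
  have : Tendsto (fun n => (v : ℝ) + (invSucc n : ℝ) - c) atTop (𝓝 ((v : ℝ) + 0 - c)) :=
    (tendsto_const_nhds.add tendsto_invSucc).sub_const c
  simpa using this

theorem upperSet_profit_le (c : ℝ) {A : Set ℝ≥0} (hA : IsUpperSet A) :
    (((sInf A : ℝ≥0) : ℝ) - c) * d.law.real A ≤ d.maxProfit c := by
  rcases A.eq_empty_or_nonempty with rfl | hne
  · simpa using d.maxProfit_nonneg c
  · rcases upperSet_eq_ray hA hne with h | h
    · calc _ = d.profit c (sInf A) := by rw [profit, ← h]
        _ ≤ _ := d.profit_le_maxProfit c _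
    · refine le_of_tendsto' (x := atTop) (f := fun n => d.profit c (sInf A + invSucc n)) ?_
        fun n => d.profit_le_maxProfit c _
      have := d.tendsto_profit_right c (sInf A)
      rwa [← h] at this

/-! ### Virtual values and prices -/

/-- The region below a line is convex, so a line above the revenue points is above the whole hull;
the nonnegative intercept takes care of the point (0, 0). -/
theorem hull_le {b c : ℝ} (h0 : 0 ≤ b)
    (hp : ∀ p : ℝ≥0, (p : ℝ) * d.law.real (Set.Ici p) ≤ b + c * d.law.real (Set.Ici p))
    {x : ℝ × ℝ} (hx : x ∈ convexHull ℝ d.revenuePoints) : x.2 ≤ b + c * x.1 := by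
  have hc : Convex ℝ {x : ℝ × ℝ | x.2 ≤ b + c * x.1} := by
    intro x hx y hy s t hs ht hst
    simp only [Set.mem_ofPred_eq, Prod.snd_add, Prod.smul_snd, smul_eq_mul, Prod.fst_add,
      Prod.smul_fst] at hx hy ⊢
    have h1 := mul_le_mul_of_nonneg_left hx hs
    have h2 := mul_le_mul_of_nonneg_left hy ht
    have h3 : b = s * b + t * b := by rw [← add_mul, hst, one_mul]
    linarith
  refine convexHull_min ?_ hc hx
  rintro _ (rfl | ⟨p, rfl⟩)
  · simpa using h0
  · exact hp p

theorem bddAbove_hull (q : ℝ) : BddAbove {r : ℝ | (q, r) ∈ convexHull ℝ d.revenuePoints} := by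
  refine ⟨d.maxProfit 0 + 0 * q, fun r hr => d.hull_le (x := (q, r)) (d.maxProfit_nonneg 0) ?_ hr⟩
  intro p
  simpa [profit] using d.profit_le_maxProfit 0 p

theorem zero_mem_hull {q : ℝ} (h0 : 0 ≤ q) (h1 : q ≤ 1) :
    (q, (0 : ℝ)) ∈ convexHull ℝ d.revenuePoints := by
  have ha : ((0 : ℝ), (0 : ℝ)) ∈ convexHull ℝ d.revenuePoints :=
    subset_convexHull ℝ _ (Or.inl rfl)
  have hb : ((1 : ℝ), (0 : ℝ)) ∈ convexHull ℝ d.revenuePoints := by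
    refine subset_convexHull ℝ _ (Or.inr ⟨0, ?_⟩)
    have : Set.Ici (0 : ℝ≥0) = Set.univ := Set.Ici_bot
    simp [this]
  have := convex_convexHull ℝ d.revenuePoints ha hb (sub_nonneg.2 h1) h0 (by ring)
  simpa using this

theorem ironedRevenue_le {b c q : ℝ} (h0 : 0 ≤ b) (hq0 : 0 ≤ q) (hq1 : q ≤ 1)
    (hp : ∀ p : ℝ≥0, (p : ℝ) * d.law.real (Set.Ici p) ≤ b + c * d.law.real (Set.Ici p)) :
    d.ironedRevenue q ≤ b + c * q :=
  csSup_le ⟨0, d.zero_mem_hull hq0 hq1⟩ fun r hr => d.hull_le (x := (q, r)) h0 hp hr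

theorem le_ironedRevenue {q r : ℝ} (h : (q, r) ∈ convexHull ℝ d.revenuePoints) :
    r ≤ d.ironedRevenue q :=
  le_csSup (d.bddAbove_hull q) h

theorem point_mem_hull (p : ℝ≥0) :
    (d.law.real (Set.Ici p), (p : ℝ) * d.law.real (Set.Ici p)) ∈ convexHull ℝ d.revenuePoints :=
  subset_convexHull ℝ _ (Or.inr ⟨p, rfl⟩)

/-- Subtracting c q tilts the ironed revenue curve into the ironed profit curve at cost c; a slope
above c means that the tilted curve rises somewhere to the right. -/
theorem lt_virtualValue_iff_slope {c : ℝ} {v : ℝ≥0} :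
    (c : EReal) < d.virtualValue v ↔ ∃ q, d.law.real (Set.Ioi v) < q ∧ q ≤ 1 ∧
      d.ironedRevenue (d.law.real (Set.Ioi v)) - c * d.law.real (Set.Ioi v) <
        d.ironedRevenue q - c * q := by
  simp only [virtualValue, lt_iSup_iff, EReal.coe_lt_coe_iff, exists_prop, Set.mem_Ioc, and_assoc]
  refine exists_congr fun q => and_congr_right fun hq => and_congr_right fun _ => ?_
  rw [lt_div_iff₀ (sub_pos.2 hq)]
  constructor <;> intro h <;> linarith

/-- The virtual value at `v` exceeds `c` iff, at cost `c`, the prices above `v` are bounded away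
from the optimal profit. -/
theorem lt_virtualValue_iff {c : ℝ} {v : ℝ≥0} :
    (c : EReal) < d.virtualValue v ↔
      ∃ h, 0 ≤ h ∧ h < d.maxProfit c ∧ ∀ p, v < p → d.profit c p ≤ h := by
  rw [lt_virtualValue_iff_slope]
  set q₀ := d.law.real (Set.Ioi v) with hq₀
  have hq₀0 : 0 ≤ q₀ := measureReal_nonneg
  have hq₀1 : q₀ ≤ 1 := measureReal_le_one
  constructor
  · rintro ⟨q, hq, hq1, hlt⟩
    -- The supremum defining the ironed curve need not be attained; `r` is an actual hull point
    -- above `q` whose tilted height still exceeds that at `q₀`.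
    obtain ⟨r, hr, hrlt⟩ := exists_lt_of_lt_csSup
      (s := {r : ℝ | (q, r) ∈ convexHull ℝ d.revenuePoints})
      ⟨0, d.zero_mem_hull (hq₀0.trans hq.le) hq1⟩
      (show d.ironedRevenue q₀ - c * q₀ + c * q < d.ironedRevenue q by linarith)
    -- The chord from a hull point on the left to `(q, r)` passes over `q₀` inside the hull. Its
    -- right end is above the tilted height at `q₀`, so its left end cannot be.
    have key : ∀ q' r', (q', r') ∈ convexHull ℝ d.revenuePoints → q' ≤ q₀ →
        r' - c * q' ≤ d.ironedRevenue q₀ - c * q₀ := by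
      intro q' r' h' hq'
      have hpos : 0 < q - q' := by linarith
      set t := (q₀ - q') / (q - q') with ht
      have ht0 : 0 ≤ t := div_nonneg (by linarith) hpos.le
      have ht1 : t < 1 := (div_lt_one hpos).2 (by linarith)
      have htq : t * (q - q') = q₀ - q' := div_mul_cancel₀ _ hpos.ne'
      have hmem := convex_convexHull ℝ d.revenuePoints h' hr (sub_nonneg.2 ht1.le) ht0 (by ring)
      have heq : (1 - t) • (q', r') + t • (q, r) = (q₀, (1 - t) * r' + t * r) := by
        ext
        · simp only [Prod.fst_add, Prod.smul_fst, smul_eq_mul]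
          linarith
        · simp
      rw [heq] at hmem
      have h1 := d.le_ironedRevenue hmem
      have h2 : t * (d.ironedRevenue q₀ - c * q₀) ≤ t * (r - c * q) :=
        mul_le_mul_of_nonneg_left (by linarith) ht0
      have h3 : (1 - t) * (r' - c * q') ≤ (1 - t) * (d.ironedRevenue q₀ - c * q₀) := by
        have : q₀ = (1 - t) * q' + t * q := by linarith
        have e : c * q₀ = (1 - t) * (c * q') + t * (c * q) := by rw [this]; ring
        linarith
      exact le_of_mul_le_mul_left h3 (by linarith)
    refine ⟨d.ironedRevenue q₀ - c * q₀, ?_, ?_, fun p hp => ?_⟩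
    · simpa using key 0 0 (d.zero_mem_hull le_rfl zero_le_one) hq₀0
    · have := d.hull_le (x := (q, r)) (c := c) (d.maxProfit_nonneg c) (fun p => by
        have := d.profit_le_maxProfit c p
        unfold profit at this
        linarith) hr
      simp only at this
      linarith
    · have := key _ _ (d.point_mem_hull p)
        (measureReal_mono (fun x hx => lt_of_lt_of_le hp hx))
      unfold profit
      linarith
  · rintro ⟨h, h0, hH, hp⟩
    set H := d.maxProfit c
    have hv : ((v : ℝ) - c) * q₀ ≤ h := le_of_tendsto' (d.tendsto_profit_right c v) fun n =>
      hp _ (lt_add_of_pos_right v (invSucc_pos n))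
    set κ := |(v : ℝ) - c| + 1 with hκ
    have hκ0 : 0 < κ := by positivity
    have hκv : (v : ℝ) - c ≤ κ := (le_abs_self _).trans (by linarith)
    set Δ := H - h with hΔ
    have hΔ0 : 0 < Δ := sub_pos.2 hH
    -- The ironed profit at `q₀` has to be kept below `H`, by the bound `h + δ = H - ε`. The two
    -- conditions on `ε` give `δ ≥ Δ / 2` and, for the extra slope `s = ε * κ / δ`, the bound `s ≤
    -- δ`.
    obtain ⟨ε, hε0, hε1, hε2⟩ : ∃ ε, 0 < ε ∧ ε ≤ Δ / 2 ∧ ε * κ ≤ (Δ / 2) ^ 2 := by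
      refine ⟨min (Δ / 2) ((Δ / 2) ^ 2 / κ), by positivity, min_le_left _ _, ?_⟩
      rw [← le_div_iff₀ hκ0]
      exact min_le_right _ _
    set δ := Δ - ε with hδ
    have hδ0 : 0 < δ := by linarith
    set s := ε * κ / δ with hs
    have hs0 : 0 ≤ s := by positivity
    have hsδ : s * δ = ε * κ := div_mul_cancel₀ _ hδ0.ne'
    have hs1 : s ≤ δ := by
      rw [hs, div_le_iff₀ hδ0]
      have : Δ / 2 ≤ δ := by linarith
      nlinarith
    -- A line of slope `c + s`, at tilted height `h + δ` over `q₀`, lies above all revenue points.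
    -- Prices above `v` have profit at most `h`. For `p ≤ v` the profit is at most `h + κ * (q -
    -- q₀)` and at most `H`; where the first bound exceeds `h + δ`, the line has already gained `ε`
    -- and reached `H`.
    have hle : d.ironedRevenue q₀ ≤ (h + δ - s * q₀) + (c + s) * q₀ := by
      have hsq : s * q₀ ≤ s := by nlinarith
      refine d.ironedRevenue_le (by linarith) hq₀0 hq₀1 fun p => ?_
      have hq0 : 0 ≤ d.law.real (Set.Ici p) := measureReal_nonneg
      set q := d.law.real (Set.Ici p)
      rcases lt_or_ge v p with hvp | hpv
      · have := hp p hvp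
        unfold profit at this
        have : 0 ≤ s * q := by positivity
        nlinarith
      · have hqq : q₀ ≤ q := measureReal_mono fun x hx => hpv.trans (le_of_lt hx)
        have hpv' : (p : ℝ) ≤ v := NNReal.coe_le_coe.2 hpv
        have h1 : ((p : ℝ) - c) * q ≤ H := d.profit_le_maxProfit c p
        have h2 : ((p : ℝ) - c) * q ≤ h + κ * (q - q₀) := by nlinarith
        have h3 : ((p : ℝ) - c) * q ≤ h + δ + s * (q - q₀) := by
          rcases le_total (κ * (q - q₀)) δ with hx | hx
          · nlinarith
          · have : ε * δ ≤ s * (q - q₀) * δ := by nlinarith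
            have := le_of_mul_le_mul_right this hδ0
            linarith
        linarith
    obtain ⟨p, hpgt⟩ := d.exists_profit_gt (c := c) (h := h + δ) (by linarith)
      (show _ < H by linarith)
    have hpv : p ≤ v := by
      by_contra! hcon
      linarith [hp p hcon]
    have hpv' : (p : ℝ) ≤ v := NNReal.coe_le_coe.2 hpv
    have hqq : q₀ ≤ d.law.real (Set.Ici p) := measureReal_mono fun x hx => hpv.trans (le_of_lt hx)
    have hge := d.le_ironedRevenue (d.point_mem_hull p)
    unfold profit at hpgt
    refine ⟨d.law.real (Set.Ici p), lt_of_le_of_ne hqq ?_, measureReal_le_one, by linarith⟩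
    -- A price up to `v` that sells with probability only `q₀` earns at most `(v - c) * q₀ ≤ h`.
    intro he
    rw [← he] at hpgt
    nlinarith

theorem virtualValue_mono : Monotone d.virtualValue := by
  intro v w hvw
  refine le_of_forall_lt fun x hx => ?_
  obtain ⟨c, hxc, hc⟩ := EReal.lt_iff_exists_real_btwn.1 hx
  obtain ⟨h, h0, hH, hp⟩ := d.lt_virtualValue_iff.1 hc
  exact hxc.trans (d.lt_virtualValue_iff.2 ⟨h, h0, hH, fun p hwp => hp p (hvw.trans_lt hwp)⟩)

/-- At cost `v` no price up to `v` makes a profit, so the prices above `v` cannot be bounded away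
from the optimum. -/
theorem virtualValue_le (v : ℝ≥0) : d.virtualValue v ≤ ((v : ℝ) : EReal) := by
  by_contra! hcon
  obtain ⟨h, h0, hH, hp⟩ := d.lt_virtualValue_iff.1 hcon
  refine absurd (d.maxProfit_le h0 fun p => ?_) (not_le.2 hH)
  rcases lt_or_ge v p with hvp | hpv
  · exact hp p hvp
  · refine le_trans (mul_nonpos_of_nonpos_of_nonneg ?_ measureReal_nonneg) h0
    exact sub_nonpos.2 (NNReal.coe_le_coe.2 hpv)

end ValueDist

namespace ValueDist

variable (d : ValueDist)

theorem isUpperSet_lt_virtualValue (c : EReal) : IsUpperSet {v | c < d.virtualValue v} :=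
  fun _ _ h hv => lt_of_lt_of_le hv (d.virtualValue_mono h)

theorem isUpperSet_le_virtualValue (c : EReal) : IsUpperSet {v | c ≤ d.virtualValue v} :=
  fun _ _ h hv => le_trans hv (d.virtualValue_mono h)

/-- Because the mean is finite, this makes the profit of high prices vanish, for negative costs too.
-/
theorem profit_le_tail (c : ℝ) {p : ℝ≥0} (hp : 1 ≤ p) :
    d.profit c p ≤ (1 + |c|) * d.tail p := by
  have h1 := d.mul_sale_le_tail p
  have hp' : (1 : ℝ) ≤ p := by exact_mod_cast hp
  have hs : 0 ≤ d.law.real (Set.Ici p) := measureReal_nonneg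
  have h2 : -c * d.law.real (Set.Ici p) ≤ |c| * (p * d.law.real (Set.Ici p)) :=
    mul_le_mul (neg_le_abs c) (le_mul_of_one_le_left hs hp') hs (abs_nonneg c)
  have h3 := mul_le_mul_of_nonneg_left h1 (abs_nonneg c)
  unfold profit
  linarith

/-- If the optimal profit were positive, all sufficiently high prices would stay away from it, and
the virtual value at a high value would exceed `c`. -/
theorem maxProfit_eq_zero {c : ℝ} (h : ∀ v, d.virtualValue v ≤ c) : d.maxProfit c = 0 := by
  refine le_antisymm ?_ (d.maxProfit_nonneg c)
  by_contra! hpos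
  have ht : Tendsto (fun n : ℕ => (1 + |c|) * d.tail n) atTop (𝓝 ((1 + |c|) * 0)) :=
    d.tendsto_tail.const_mul _
  rw [mul_zero] at ht
  obtain ⟨n, hn, hn1⟩ := ((ht.eventually (gt_mem_nhds hpos)).and (eventually_ge_atTop 1)).exists
  have hn1' : (1 : ℝ≥0) ≤ n := by exact_mod_cast hn1
  have h0 : 0 ≤ d.tail n := integral_nonneg fun x => x.2
  refine absurd (d.lt_virtualValue_iff.2 ⟨_, by positivity, hn, fun p hp => ?_⟩)
    (not_lt.2 (h n))
  refine (d.profit_le_tail c (hn1'.trans hp.le)).trans ?_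
  exact mul_le_mul_of_nonneg_left (d.tail_antitone hp.le) (by positivity)

/-- The lowest value with virtual value above `c` is an optimal price at cost `c`. -/
theorem maxProfit_eq_of_lt (c : ℝ) :
    d.maxProfit c = (((sInf {v | (c : EReal) < d.virtualValue v} : ℝ≥0) : ℝ) - c) *
      d.law.real {v | (c : EReal) < d.virtualValue v} := by
  set A := {v | (c : EReal) < d.virtualValue v} with hA
  have hup : IsUpperSet A := d.isUpperSet_lt_virtualValue c
  refine le_antisymm ?_ (d.upperSet_profit_le c hup)
  rcases A.eq_empty_or_nonempty with he | hne
  · rw [he, measureReal_empty, mul_zero]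
    refine (d.maxProfit_eq_zero fun v => ?_).le
    by_contra! hcon
    exact Set.notMem_empty v (he ▸ hcon)
  have hin : ∀ v ∈ A, ∃ h, 0 ≤ h ∧ h < d.maxProfit c ∧ ∀ p, v < p → d.profit c p ≤ h :=
    fun v hv => d.lt_virtualValue_iff.1 hv
  have hout : ∀ v, v ∉ A → ∀ h, 0 ≤ h → h < d.maxProfit c → ∃ p, v < p ∧ h < d.profit c p := by
    intro v hv h h0 hh
    by_contra! hcon
    exact hv (d.lt_virtualValue_iff.2 ⟨h, h0, hh, hcon⟩)
  set T := sInf A with hT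
  have hbelow : ∀ v, v < T → v ∉ A := fun v hv hvA =>
    absurd (csInf_le (OrderBot.bddBelow A) hvA) (not_le.2 hv)
  refine le_of_forall_lt fun h' hh' => ?_
  obtain ⟨h, hhh', hhH⟩ := exists_between hh'
  refine lt_of_lt_of_le hhh' ?_
  -- Membership in `A` forces near-optimal prices to lie weakly below a value, non-membership yields
  -- near-optimal prices above it. If `T ∈ A`, they accumulate at `T` from below; if `T ∉ A`, from
  -- above. Either way the limit is the profit of serving exactly `A`.
  rcases upperSet_eq_ray hup hne with hray | hray
  · have hTA : T ∈ A := by rw [hray]; exact Set.self_mem_Ici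
    obtain ⟨k, hk0, hkH, hk⟩ := hin T hTA
    have hm0 : 0 ≤ max h k := hk0.trans (le_max_right _ _)
    have hmH : max h k < d.maxProfit c := max_lt hhH hkH
    have hp : ∀ n, ∃ p, T - invSucc n ≤ p ∧ p ≤ T ∧ max h k < d.profit c p := by
      intro n
      have hpT : ∀ p, max h k < d.profit c p → p ≤ T := fun p hp => by
        by_contra! hcon
        exact absurd (hk p hcon) (not_le.2 ((le_max_right _ _).trans_lt hp))
      -- Below `T = 0` there are no values to use, but then truncated subtraction makes the lower
      -- bound on `p` trivial.
      rcases eq_or_ne T 0 with h0 | h0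
      · obtain ⟨p, hp⟩ := d.exists_profit_gt hm0 hmH
        exact ⟨p, by simp [h0], hpT p hp, hp⟩
      · obtain ⟨p, hp1, hp2⟩ := hout (T - invSucc n)
          (hbelow _ (tsub_lt_self (pos_iff_ne_zero.2 h0) (invSucc_pos n))) _ hm0 hmH
        exact ⟨p, hp1.le, hpT p hp2, hp2⟩
    -- The margin must be nonnegative, for the sale probability is enlarged below.
    have hTc : 0 ≤ (T : ℝ) - c := by
      obtain ⟨p, -, hpT, hp⟩ := hp 0
      have hpT' : (p : ℝ) ≤ T := NNReal.coe_le_coe.2 hpT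
      have hpos : 0 < d.profit c p := hm0.trans_lt hp
      have := pos_of_mul_pos_left hpos measureReal_nonneg
      linarith
    have hlim := (tendsto_real_Ici_sub_invSucc d.law T).const_mul ((T : ℝ) - c)
    rw [← hray] at hlim
    refine ge_of_tendsto' hlim fun n => ?_
    obtain ⟨p, hp1, hpT, hp⟩ := hp n
    have hpT' : (p : ℝ) ≤ T := NNReal.coe_le_coe.2 hpT
    refine ((le_max_left h k).trans hp.le).trans ?_
    exact mul_le_mul (by linarith) (measureReal_mono (Set.Ici_subset_Ici.2 hp1))
      measureReal_nonneg hTc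
  · have hTA : T ∉ A := by rw [hray]; exact Set.self_notMem_Ioi
    have hlim : Tendsto (fun n => ((T : ℝ) + (invSucc n : ℝ) - c) * d.law.real A) atTop
        (𝓝 (((T : ℝ) + 0 - c) * d.law.real A)) :=
      ((tendsto_const_nhds.add tendsto_invSucc).sub_const c).mul_const _
    rw [add_zero] at hlim
    refine ge_of_tendsto' hlim fun n => ?_
    have hTn : T + invSucc n ∈ A := by
      rw [hray]
      exact lt_add_of_pos_right T (invSucc_pos n)
    obtain ⟨k, hk0, hkH, hk⟩ := hin _ hTn
    obtain ⟨p, hTp, hp⟩ := hout T hTA (max h k) (hk0.trans (le_max_right _ _)) (max_lt hhH hkH)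
    have hpn : p ≤ T + invSucc n := by
      by_contra! hcon
      exact absurd (hk p hcon) (not_le.2 ((le_max_right _ _).trans_lt hp))
    have hpn' : (p : ℝ) ≤ (T : ℝ) + (invSucc n : ℝ) := by exact_mod_cast hpn
    have hpos : 0 < d.profit c p := (hk0.trans (le_max_right h k)).trans_lt hp
    have hpc := pos_of_mul_pos_left hpos measureReal_nonneg
    refine ((le_max_left h k).trans hp.le).trans ?_
    refine mul_le_mul (by linarith) (measureReal_mono fun x hx => ?_) measureReal_nonneg
      (by linarith)
    rw [hray]
    exact lt_of_lt_of_le hTp hx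

/-- The lowest value with virtual value at least `c` is an optimal price at cost `c`. -/
theorem maxProfit_eq_of_le (c : ℝ) :
    d.maxProfit c = (((sInf {v | (c : EReal) ≤ d.virtualValue v} : ℝ≥0) : ℝ) - c) *
      d.law.real {v | (c : EReal) ≤ d.virtualValue v} := by
  set A := {v | (c : EReal) ≤ d.virtualValue v} with hA
  have hup : IsUpperSet A := d.isUpperSet_le_virtualValue c
  refine le_antisymm ?_ (d.upperSet_profit_le c hup)
  rcases A.eq_empty_or_nonempty with he | hne
  · rw [he, measureReal_empty, mul_zero]
    refine (d.maxProfit_eq_zero fun v => ?_).le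
    by_contra! hcon
    exact Set.notMem_empty v (he ▸ hcon.le)
  -- The weak superlevel set is the decreasing intersection of strict ones at costs tending to `c`
  -- from below, whose optimal profits are at least that at `c`.
  set B : ℕ → Set ℝ≥0 := fun n => {v | ((c - (invSucc n : ℝ) : ℝ) : EReal) < d.virtualValue v}
    with hB
  have hBA : (⋂ n, B n) = A := by
    ext v
    simp only [Set.mem_iInter, hB, hA, Set.mem_ofPred_eq]
    constructor
    · intro h
      have hlim : Tendsto (fun n => ((c - (invSucc n : ℝ) : ℝ) : EReal)) atTop
          (𝓝 ((c - 0 : ℝ) : EReal)) :=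
        (continuous_coe_real_ereal.tendsto _).comp (tendsto_invSucc.const_sub c)
      rw [sub_zero] at hlim
      exact le_of_tendsto' hlim fun n => (h n).le
    · intro h n
      refine lt_of_lt_of_le (EReal.coe_lt_coe_iff.2 ?_) h
      exact sub_lt_self c (invSucc_pos n)
  have hBanti : Antitone B := fun m n hmn v hv => by
    refine lt_of_le_of_lt (EReal.coe_le_coe_iff.2 ?_) hv
    have : (invSucc n : ℝ) ≤ invSucc m := NNReal.coe_le_coe.2 (invSucc_antitone hmn)
    linarith
  have hlim : Tendsto (fun n => ((sInf A : ℝ≥0) - (c - (invSucc n : ℝ))) * d.law.real (B n)) atTop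
      (𝓝 (((sInf A : ℝ≥0) - (c - 0)) * d.law.real (⋂ n, B n))) :=
    ((tendsto_invSucc.const_sub c).const_sub _).mul (tendsto_real_iInter d.law hBanti fun n =>
      (measurableSet_of_isUpperSet (d.isUpperSet_lt_virtualValue _)))
  rw [hBA, sub_zero] at hlim
  refine ge_of_tendsto' hlim fun n => ?_
  refine (d.maxProfit_antitone (sub_le_self c (invSucc_pos n).le)).trans ?_
  rw [maxProfit_eq_of_lt]
  refine mul_le_mul_of_nonneg_right ?_ measureReal_nonneg
  refine sub_le_sub_right (NNReal.coe_le_coe.2 (csInf_le_csInf (OrderBot.bddBelow _) hne ?_)) _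
  rw [← hBA]
  exact Set.iInter_subset _ n

/-! ### Virtual surplus -/

/-- The positive part of the virtual value. -/
def posVV (v : ℝ≥0) : ℝ≥0 := (d.virtualValue v).toReal.toNNReal

theorem virtualValue_ne_top (v : ℝ≥0) : d.virtualValue v ≠ ⊤ :=
  ((d.virtualValue_le v).trans_lt (EReal.coe_lt_top _)).ne

theorem lt_posVV_iff {c : ℝ} (hc : 0 ≤ c) {v : ℝ≥0} :
    c < d.posVV v ↔ (c : EReal) < d.virtualValue v := by
  have htop := d.virtualValue_ne_top v
  unfold posVV
  generalize d.virtualValue v = x at *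
  -- `EReal.toReal` sends `⊥` to 0, which is the desired positive part; at `⊤` the value 0 would be
  -- wrong, but `⊤` does not occur.
  induction x with
  | bot => simpa using hc
  | top => exact absurd rfl htop
  | coe r => simp [Real.coe_toNNReal', not_lt.2 hc]

theorem posVV_le_iff {c : ℝ} (hc : 0 ≤ c) {v : ℝ≥0} :
    d.posVV v ≤ c ↔ d.virtualValue v ≤ (c : EReal) := by
  rw [← not_lt, ← not_lt, d.lt_posVV_iff hc]

theorem coe_posVV {v : ℝ≥0} (h : 0 ≤ d.virtualValue v) :
    ((d.posVV v : ℝ) : EReal) = d.virtualValue v := by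
  rw [posVV, Real.coe_toNNReal _ (EReal.toReal_nonneg h), EReal.coe_toReal (d.virtualValue_ne_top v)]
  rintro h'
  simp [h'] at h

theorem posVV_le (v : ℝ≥0) : d.posVV v ≤ v := by
  have := (d.posVV_le_iff v.2).2 (d.virtualValue_le v)
  exact_mod_cast this

theorem posVV_mono : Monotone d.posVV := fun v w h => by
  have : (d.posVV v : ℝ) ≤ d.posVV w :=
    (d.posVV_le_iff (d.posVV w).2).2 ((d.virtualValue_mono h).trans
      ((d.posVV_le_iff (d.posVV w).2).1 le_rfl))
  exact_mod_cast this

theorem measurable_posVV : Measurable d.posVV := d.posVV_mono.measurable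

theorem integrable_posVV : Integrable (fun v => (d.posVV v : ℝ)) d.law :=
  d.finiteMean.mono' d.measurable_posVV.coe_nnreal_real.aestronglyMeasurable
    (Eventually.of_forall fun v => by
      rw [Real.norm_of_nonneg (NNReal.coe_nonneg _)]
      exact NNReal.coe_le_coe.2 (d.posVV_le v))

/-! ### The optimal profit as an expected excess of the virtual value. -/

/-- The expected excess of the virtual value over `c`. -/
def excess (c : ℝ) : ℝ := ∫ v, max ((d.posVV v : ℝ) - c) 0 ∂d.law

theorem integrable_excess (c : ℝ) : Integrable (fun v => max ((d.posVV v : ℝ) - c) 0) d.law :=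
  (d.integrable_posVV.sub (integrable_const c)).pos_part

/-- Raising the level from `c` to `c'` lowers the integrand by exactly `c' - c` where φ > c', by at
most that where φ > c, and by nothing elsewhere. -/
theorem excess_sub_mem {c c' : ℝ} (hc : 0 ≤ c) (hcc : c ≤ c') :
    (c' - c) * d.law.real {v | (c' : EReal) < d.virtualValue v} ≤ d.excess c - d.excess c' ∧
      d.excess c - d.excess c' ≤ (c' - c) * d.law.real {v | (c : EReal) < d.virtualValue v} := by
  have hm : ∀ x : ℝ, MeasurableSet {v | (x : EReal) < d.virtualValue v} := fun x =>
    (measurableSet_of_isUpperSet (d.isUpperSet_lt_virtualValue x))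
  have hi : ∀ x : ℝ, (c' - c) * d.law.real {v | (x : EReal) < d.virtualValue v} =
      ∫ v, Set.indicator {v | (x : EReal) < d.virtualValue v} (fun _ => c' - c) v ∂d.law := by
    intro x
    rw [integral_indicator (hm x), setIntegral_const, smul_eq_mul, mul_comm]
  have hii : ∀ x : ℝ, Integrable
      (Set.indicator {v | (x : EReal) < d.virtualValue v} (fun _ => c' - c)) d.law := fun x =>
    (integrable_const _).indicator (hm x)
  unfold excess
  rw [← integral_sub (d.integrable_excess c) (d.integrable_excess c'), hi, hi]
  have hsub := (d.integrable_excess c).sub (d.integrable_excess c')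
  constructor
  · refine integral_mono (hii c') hsub fun v => ?_
    by_cases hv : v ∈ {v | (c' : EReal) < d.virtualValue v}
    · have h1 := (d.lt_posVV_iff (hc.trans hcc)).2 hv
      rw [Set.indicator_of_mem hv, max_eq_left (by linarith), max_eq_left (by linarith)]
      linarith
    · rw [Set.indicator_of_notMem hv]
      have : max ((d.posVV v : ℝ) - c') 0 ≤ max ((d.posVV v : ℝ) - c) 0 :=
        max_le_max (by linarith) le_rfl
      linarith
  · refine integral_mono hsub (hii c) fun v => ?_
    by_cases hv : v ∈ {v | (c : EReal) < d.virtualValue v}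
    · have h1 := (d.lt_posVV_iff hc).2 hv
      rw [Set.indicator_of_mem hv, max_eq_left (a := (d.posVV v : ℝ) - c) (by linarith)]
      have := le_max_left ((d.posVV v : ℝ) - c') 0
      linarith
    · have h1 := (d.posVV_le_iff hc).2 (not_lt.1 hv)
      rw [Set.indicator_of_notMem hv, max_eq_right (by linarith), max_eq_right (by linarith)]
      simp

/-- Envelope argument: the optimal price for one cost is available at the other cost. The bounds are
those of `excess_sub_mem`, so the two functions have increments that agree up to the variation of a
sale probability. -/
theorem maxProfit_sub_mem (c c' : ℝ) :
    (c' - c) * d.law.real {v | (c' : EReal) < d.virtualValue v} ≤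
        d.maxProfit c - d.maxProfit c' ∧
      d.maxProfit c - d.maxProfit c' ≤
        (c' - c) * d.law.real {v | (c : EReal) < d.virtualValue v} := by
  have h1 := d.maxProfit_eq_of_lt c
  have h2 := d.maxProfit_eq_of_lt c'
  have h3 := d.upperSet_profit_le c (d.isUpperSet_lt_virtualValue c')
  have h4 := d.upperSet_profit_le c' (d.isUpperSet_lt_virtualValue c)
  constructor <;> linarith

end ValueDist

/-- A function whose increments are controlled by those of a monotone function, up to a factor
of the step length, is constant. -/
theorem eq_of_abs_sub_le {f a : ℝ → ℝ}
    (h : ∀ c c', 0 ≤ c → c ≤ c' → |f c - f c'| ≤ (c' - c) * (a c - a c'))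
    {c c' : ℝ} (hc : 0 ≤ c) (hcc : c ≤ c') : f c = f c' := by
  have hN : ∀ n : ℕ, dist (f c) (f c') ≤ (c' - c) * (a c - a c') * invSucc n := by
    intro n
    set N : ℕ := n + 1 with hN
    have hN0 : (0 : ℝ) < N := by positivity
    set x : ℕ → ℝ := fun k => c + k * ((c' - c) / N) with hx
    have hstep : 0 ≤ (c' - c) / N := div_nonneg (by linarith) hN0.le
    have hx0 : x 0 = c := by simp [hx]
    have hxN : x N = c' := by simp only [hx]; field_simp; ring
    have hd : ∀ k, x (k + 1) - x k = (c' - c) / N := fun k => by simp only [hx]; push_cast; ring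
    have h1 := dist_le_range_sum_dist (fun k => f (x k)) N
    have h2 : ∑ k ∈ Finset.range N, dist (f (x k)) (f (x (k + 1))) ≤
        ∑ k ∈ Finset.range N, (c' - c) / N * (a (x k) - a (x (k + 1))) := by
      refine Finset.sum_le_sum fun k _ => ?_
      rw [Real.dist_eq]
      have := h (x k) (x (k + 1)) (by simp only [hx]; positivity) (by linarith [hd k])
      rwa [hd] at this
    -- The increments of `a` telescope, so the total error is a single step length times a constant
    -- and vanishes as the subdivision is refined.
    rw [← Finset.mul_sum, Finset.sum_range_sub'] at h2
    rw [hx0, hxN] at h1 h2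
    refine (h1.trans h2).trans (le_of_eq ?_)
    simp only [invSucc, hN]
    push_cast
    field_simp
  have hlim := tendsto_invSucc.const_mul ((c' - c) * (a c - a c'))
  rw [mul_zero] at hlim
  exact dist_le_zero.1 (ge_of_tendsto' hlim hN)

namespace ValueDist

variable (d : ValueDist)

theorem maxProfit_le_tail (n : ℕ) : d.maxProfit n ≤ d.tail n := by
  refine d.maxProfit_le (integral_nonneg fun x => x.2) fun p => ?_
  rcases lt_or_ge (n : ℝ≥0) p with hp | hp
  · refine le_trans ?_ ((d.mul_sale_le_tail p).trans (d.tail_antitone hp.le))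
    exact mul_le_mul_of_nonneg_right (sub_le_self _ (Nat.cast_nonneg n)) measureReal_nonneg
  · have hp' : (p : ℝ) ≤ n := by exact_mod_cast hp
    exact (mul_nonpos_of_nonpos_of_nonneg (by linarith) measureReal_nonneg).trans
      (integral_nonneg fun x => x.2)

theorem excess_le_tail (n : ℕ) : d.excess n ≤ d.tail n := by
  rw [tail, ← integral_indicator measurableSet_Ici]
  refine integral_mono (d.integrable_excess n) (d.finiteMean.indicator measurableSet_Ici)
    fun v => ?_
  have hle : (d.posVV v : ℝ) ≤ v := NNReal.coe_le_coe.2 (d.posVV_le v)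
  have hn : (0 : ℝ) ≤ n := Nat.cast_nonneg n
  by_cases hv : (n : ℝ≥0) ≤ v
  · rw [Set.indicator_of_mem (Set.mem_Ici.2 hv)]
    exact max_le (by linarith) v.2
  · rw [Set.indicator_of_notMem (by simpa using hv)]
    have : (v : ℝ) ≤ n := by exact_mod_cast (not_le.1 hv).le
    exact max_le (by linarith) le_rfl

theorem excess_nonneg (c : ℝ) : 0 ≤ d.excess c := integral_nonneg fun _ => le_max_right _ _

/-- The optimal profit at cost `c` is the expected excess of the virtual value over `c`. -/
theorem maxProfit_eq_excess {c : ℝ} (hc : 0 ≤ c) : d.maxProfit c = d.excess c := by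
  have hconst : ∀ c', c ≤ c' →
      d.maxProfit c - d.excess c = d.maxProfit c' - d.excess c' := fun c' hcc =>
    eq_of_abs_sub_le (f := fun x => d.maxProfit x - d.excess x)
      (a := fun x => d.law.real {v | (x : EReal) < d.virtualValue v})
      (fun x y hx hxy => by
        have h1 := d.maxProfit_sub_mem x y
        have h2 := d.excess_sub_mem hx hxy
        rw [abs_le, mul_sub]
        constructor <;> linarith [h1.1, h1.2, h2.1, h2.2]) hc hcc
  have hlim : Tendsto (fun n : ℕ => d.maxProfit n - d.excess n) atTop (𝓝 0) := by
    refine squeeze_zero_norm (fun n => ?_) d.tendsto_tail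
    rw [Real.norm_eq_abs, abs_le]
    have h1 := d.maxProfit_le_tail n
    have h2 := d.excess_le_tail n
    have h3 := d.maxProfit_nonneg n
    have h4 := d.excess_nonneg n
    constructor <;> linarith
  have hev : (fun n : ℕ => d.maxProfit n - d.excess n) =ᶠ[atTop]
      fun _ => d.maxProfit c - d.excess c := by
    obtain ⟨m, hm⟩ := exists_nat_ge c
    filter_upwards [eventually_ge_atTop m] with n hn
    exact (hconst n (hm.trans (by exact_mod_cast hn))).symm
  have := tendsto_nhds_unique (hlim.congr' hev) tendsto_const_nhds
  linarith

/-- The virtual surplus on a set that is a superlevel set of the virtual value at `c`. -/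
theorem setIntegral_posVV_eq {A : Set ℝ≥0} (hA : MeasurableSet A) {c : ℝ}
    (h1 : ∀ v ∈ A, c ≤ d.posVV v) (h2 : ∀ v, v ∉ A → d.posVV v ≤ c) :
    ∫ v in A, (d.posVV v : ℝ) ∂d.law = d.excess c + c * d.law.real A := by
  have he : d.excess c = ∫ v in A, ((d.posVV v : ℝ) - c) ∂d.law := by
    rw [excess, ← integral_indicator hA]
    refine integral_congr_ae (Eventually.of_forall fun v => ?_)
    by_cases hv : v ∈ A
    · simp [hv, h1 v hv]
    · simp [hv, h2 v hv]
  rw [he, integral_sub d.integrable_posVV.integrableOn (integrable_const c).integrableOn,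
    setIntegral_const, smul_eq_mul]
  ring

/-- Posting a price yields at most the virtual surplus of the values served. -/
theorem mul_real_le_setIntegral_posVV {A : Set ℝ≥0} (hA : IsUpperSet A) :
    ((sInf A : ℝ≥0) : ℝ) * d.law.real A ≤ ∫ v in A, (d.posVV v : ℝ) ∂d.law := by
  set T := sInf A
  have h1 : ∀ v ∈ A, (d.posVV T : ℝ) ≤ d.posVV v := fun v hv =>
    NNReal.coe_le_coe.2 (d.posVV_mono (csInf_le (OrderBot.bddBelow A) hv))
  rcases A.eq_empty_or_nonempty with he | hne
  · simp [he]
  have h2 : ∀ v, v ∉ A → (d.posVV v : ℝ) ≤ d.posVV T := fun v hv => by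
    refine NNReal.coe_le_coe.2 (d.posVV_mono ?_)
    by_contra! hlt
    obtain ⟨w, hw, hwv⟩ := (csInf_lt_iff (OrderBot.bddBelow A) hne).1 hlt
    exact hv (hA hwv.le hw)
  -- `A` is a superlevel set at the level `d.posVV T`. Taken as the cost c, it turns the integral
  -- into H(c) + c Pr[A], while the price `T` earns a profit of at most H(c).
  rw [d.setIntegral_posVV_eq (measurableSet_of_isUpperSet hA) h1 h2,
    ← d.maxProfit_eq_excess (NNReal.coe_nonneg _)]
  linarith [d.upperSet_profit_le (d.posVV T) hA]

/-- The threshold is an optimal price at cost `c`, so the bound of `mul_real_le_setIntegral_posVV`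
is attained. -/
theorem mul_real_eq_setIntegral_of_le {c : ℝ} (hc : 0 ≤ c) :
    ((sInf {v | (c : EReal) ≤ d.virtualValue v} : ℝ≥0) : ℝ) *
      d.law.real {v | (c : EReal) ≤ d.virtualValue v} =
      ∫ v in {v | (c : EReal) ≤ d.virtualValue v}, (d.posVV v : ℝ) ∂d.law := by
  rw [d.setIntegral_posVV_eq (measurableSet_of_isUpperSet (d.isUpperSet_le_virtualValue _)) (c := c),
    ← d.maxProfit_eq_excess hc, d.maxProfit_eq_of_le]
  · ring
  · intro v hv
    rw [← EReal.coe_le_coe_iff, d.coe_posVV (le_trans (by exact_mod_cast hc) hv)]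
    exact hv
  · exact fun v hv => (d.posVV_le_iff hc).2 (not_le.1 hv).le

theorem mul_real_eq_setIntegral_of_lt {c : ℝ} (hc : 0 ≤ c) :
    ((sInf {v | (c : EReal) < d.virtualValue v} : ℝ≥0) : ℝ) *
      d.law.real {v | (c : EReal) < d.virtualValue v} =
      ∫ v in {v | (c : EReal) < d.virtualValue v}, (d.posVV v : ℝ) ∂d.law := by
  rw [d.setIntegral_posVV_eq (measurableSet_of_isUpperSet (d.isUpperSet_lt_virtualValue _)) (c := c),
    ← d.maxProfit_eq_excess hc, d.maxProfit_eq_of_lt]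
  · ring
  · exact fun v hv => ((d.lt_posVV_iff hc).2 hv).le
  · exact fun v hv => (d.posVV_le_iff hc).2 (not_lt.1 hv)

end ValueDist

/-! ### The revenue from a single buyer -/

/-- A buyer whose types are the support of `d` and who is offered an incentive compatible and
individually rational menu pays on average at most his expected virtual surplus. -/
theorem ValueDist.integral_payment_le (d : ValueDist) {X P : ℝ≥0 → ℝ}
    (hXm : AEStronglyMeasurable X d.law) (hP : Integrable P d.law)
    (hX0 : ∀ b ∈ d.law.support, 0 ≤ X b) (hX1 : ∀ b ∈ d.law.support, X b ≤ 1)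
    (hIC : ∀ x ∈ d.law.support, ∀ b ∈ d.law.support, x * X b - P b ≤ x * X x - P x)
    (hIR : ∀ x ∈ d.law.support, 0 ≤ x * X x - P x) :
    ∫ v, P v ∂d.law ≤ ∫ v, (d.posVV v : ℝ) * X v ∂d.law := by
  set S := d.law.support with hS
  have hae : ∀ᵐ v ∂d.law, v ∈ S := Measure.support_mem_ae
  have hmono : ∀ x ∈ S, ∀ y ∈ S, x ≤ y → X x ≤ X y := by
    intro x hx y hy hxy
    rcases hxy.eq_or_lt with rfl | hlt
    · exact le_rfl
    have hlt' : (x : ℝ) < y := NNReal.coe_lt_coe.2 hlt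
    have h1 := hIC x hx y hy
    have h2 := hIC y hy x hx
    by_contra! hcon
    nlinarith
  have hint : Integrable (fun v => (d.posVV v : ℝ) * X v) d.law := by
    refine d.integrable_posVV.mono'
      (d.measurable_posVV.coe_nnreal_real.aestronglyMeasurable.mul hXm) ?_
    filter_upwards [hae] with v hv
    rw [Real.norm_of_nonneg (mul_nonneg (NNReal.coe_nonneg _) (hX0 v hv))]
    exact mul_le_of_le_one_right (NNReal.coe_nonneg _) (hX1 v hv)
  -- The monotone allocation is cut into `n + 1` layers of height `ε`; each layer acts like a posted
  -- price `T k` for a share `ε` of the good. Rounding costs at most `v * ε` per type, which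
  -- disappears in the limit.
  have key : ∀ n : ℕ, ∫ v, P v ∂d.law ≤
      (∫ v, (v : ℝ) ∂d.law) * invSucc n + ∫ v, (d.posVV v : ℝ) * X v ∂d.law := by
    intro n
    set ε : ℝ := (invSucc n : ℝ) with hε
    have hε0 : 0 < ε := invSucc_pos n
    have hnε : ((n + 1 : ℕ) : ℝ) * ε = 1 := by
      simp only [hε, invSucc]
      push_cast
      field_simp
    -- Monotonicity of `X` is known only on the support, so the up-set generated by the types of the
    -- support is used.
    set A : ℕ → Set ℝ≥0 := fun k => {v | ∃ b ∈ S, k * ε ≤ X b ∧ b ≤ v} with hA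
    have hAup : ∀ k, IsUpperSet (A k) := fun k v w hvw ⟨b, hb, hbX, hbv⟩ =>
      ⟨b, hb, hbX, hbv.trans hvw⟩
    have hAS : ∀ k, ∀ v ∈ S, v ∈ A k ↔ k * ε ≤ X v := fun k v hv =>
      ⟨fun ⟨b, hb, hbX, hbv⟩ => hbX.trans (hmono b hb v hv hbv), fun h => ⟨v, hv, h, le_rfl⟩⟩
    set T : ℕ → ℝ := fun k => ((sInf (A k) : ℝ≥0) : ℝ) with hT
    -- Discrete envelope formula: a type served up to layer `k` keeps at least the surplus of buying
    -- each layer at its threshold. The induction lets `v` imitate types `b` near the threshold of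
    -- the next layer.
    have hU : ∀ k : ℕ, ∀ v ∈ S, k * ε ≤ X v →
        v * (k * ε) - ε * ∑ j ∈ Finset.range k, T (j + 1) ≤ v * X v - P v := by
      intro k
      induction k with
      | zero => intro v hv _; simpa using hIR v hv
      | succ k ih =>
        intro v hv hXv
        set σ := ∑ j ∈ Finset.range k, T (j + 1) with hσ
        have hlow : ∀ b ∈ S, ((k + 1 : ℕ) : ℝ) * ε ≤ X b → b ≤ v →
            v * ((k + 1 : ℕ) * ε) - ε * b - ε * σ ≤ v * X v - P v := by
          intro b hb hXb hbv
          have hbv' : (b : ℝ) ≤ v := NNReal.coe_le_coe.2 hbv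
          push_cast at hXb ⊢
          have h1 := ih b hb (by linarith)
          have h2 := hIC v hv b hb
          have h3 := mul_le_mul_of_nonneg_left hXb (sub_nonneg.2 hbv')
          linarith
        have hTle : (v * ((k + 1 : ℕ) * ε) - ε * σ - (v * X v - P v)) / ε ≤ T (k + 1) := by
          rw [hT, ← Real.toNNReal_le_iff_le_coe]
          -- The infimum is taken in `ℝ≥0`, hence the passage through `Real.toNNReal`. A generating
          -- type above `v` is replaced by `v` itself.
          refine le_csInf ⟨v, (hAS _ v hv).2 hXv⟩ ?_
          rintro a ⟨b, hb, hXb, hba⟩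
          rw [Real.toNNReal_le_iff_le_coe, div_le_iff₀ hε0]
          rcases le_total b v with hbv | hvb
          · have h1 := hlow b hb hXb hbv
            have h2 : (b : ℝ) * ε ≤ a * ε :=
              mul_le_mul_of_nonneg_right (NNReal.coe_le_coe.2 hba) hε0.le
            linarith
          · have h1 := hlow v hv hXv le_rfl
            have h2 : (v : ℝ) * ε ≤ a * ε :=
              mul_le_mul_of_nonneg_right (NNReal.coe_le_coe.2 (hvb.trans hba)) hε0.le
            linarith
        rw [div_le_iff₀ hε0] at hTle
        rw [Finset.sum_range_succ]
        linarith
    have hfloor : ∀ v ∈ S, ∃ k ≤ n + 1, (k : ℝ) * ε ≤ X v ∧ X v ≤ k * ε + ε ∧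
        ∀ j, v ∈ A (j + 1) ↔ j < k := by
      intro v hv
      have hXε : 0 ≤ X v / ε := div_nonneg (hX0 v hv) hε0.le
      refine ⟨⌊X v / ε⌋₊, ?_, ?_, ?_, fun j => ?_⟩
      · refine Nat.floor_le_of_le ?_
        rw [div_le_iff₀ hε0, hnε]
        exact hX1 v hv
      · rw [← le_div_iff₀ hε0]
        exact Nat.floor_le hXε
      · rw [← add_one_mul, ← div_le_iff₀ hε0]
        exact (Nat.lt_floor_add_one _).le
      · rw [hAS _ v hv, ← le_div_iff₀ hε0, ← Nat.le_floor_iff hXε, Nat.succ_le_iff]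
    have hcount : ∀ (v : ℝ≥0) (k : ℕ) (t : ℕ → ℝ), k ≤ n + 1 → (∀ j, v ∈ A (j + 1) ↔ j < k) →
        ∑ j ∈ Finset.range (n + 1), (A (j + 1)).indicator (fun _ => t j) v =
          ∑ j ∈ Finset.range k, t j := by
      intro v k t hk hjk
      rw [← Finset.sum_subset (Finset.range_subset_range.2 hk)]
      · refine Finset.sum_congr rfl fun j hj => ?_
        rw [Set.indicator_of_mem ((hjk j).2 (Finset.mem_range.1 hj))]
      · intro j _ hj
        rw [Set.indicator_of_notMem fun h => hj (Finset.mem_range.2 ((hjk j).1 h))]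
    have hAm : ∀ k, MeasurableSet (A k) := fun k => measurableSet_of_isUpperSet (hAup k)
    have hP1 : ∀ᵐ v ∂d.law, P v ≤ v * ε +
        ∑ j ∈ Finset.range (n + 1), (A (j + 1)).indicator (fun _ => ε * T (j + 1)) v := by
      filter_upwards [hae] with v hv
      obtain ⟨k, hk, hk1, hk2, hk3⟩ := hfloor v hv
      rw [hcount v k _ hk hk3, ← Finset.mul_sum]
      have h1 := hU k v hv hk1
      have h2 := mul_le_mul_of_nonneg_left hk2 (NNReal.coe_nonneg v)
      linarith
    have hP2 : ∀ᵐ v ∂d.law,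
        ∑ j ∈ Finset.range (n + 1), (A (j + 1)).indicator (fun w => ε * (d.posVV w : ℝ)) v ≤
          (d.posVV v : ℝ) * X v := by
      filter_upwards [hae] with v hv
      obtain ⟨k, hk, hk1, hk2, hk3⟩ := hfloor v hv
      have := hcount v k (fun _ => ε * (d.posVV v : ℝ)) hk hk3
      rw [Finset.sum_const, Finset.card_range, nsmul_eq_mul] at this
      calc _ = (k : ℝ) * (ε * (d.posVV v : ℝ)) := this
        _ = (d.posVV v : ℝ) * (k * ε) := by ring
        _ ≤ _ := mul_le_mul_of_nonneg_left hk1 (NNReal.coe_nonneg _)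
    have hi1 : ∀ j ∈ Finset.range (n + 1),
        Integrable ((A (j + 1)).indicator fun _ => ε * T (j + 1)) d.law := fun j _ =>
      (integrable_const _).indicator (hAm _)
    have hi2 : ∀ j ∈ Finset.range (n + 1),
        Integrable ((A (j + 1)).indicator fun w => ε * (d.posVV w : ℝ)) d.law := fun j _ =>
      (d.integrable_posVV.const_mul ε).indicator (hAm _)
    calc ∫ v, P v ∂d.law
        ≤ ∫ v, ((v : ℝ) * ε + ∑ j ∈ Finset.range (n + 1),
            (A (j + 1)).indicator (fun _ => ε * T (j + 1)) v) ∂d.law :=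
          integral_mono_ae hP ((d.finiteMean.mul_const ε).add (integrable_finsetSum _ hi1)) hP1
      _ = (∫ v, (v : ℝ) ∂d.law) * ε +
            ∑ j ∈ Finset.range (n + 1), ε * (T (j + 1) * d.law.real (A (j + 1))) := by
          rw [integral_add (d.finiteMean.mul_const ε) (integrable_finsetSum _ hi1),
            integral_mul_const, integral_finsetSum _ hi1]
          congr 1
          refine Finset.sum_congr rfl fun j _ => ?_
          rw [integral_indicator (hAm _), setIntegral_const, smul_eq_mul]
          ring
      _ ≤ (∫ v, (v : ℝ) ∂d.law) * ε +
            ∑ j ∈ Finset.range (n + 1), ε * ∫ v in A (j + 1), (d.posVV v : ℝ) ∂d.law := by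
          gcongr with j _
          exact d.mul_real_le_setIntegral_posVV (hAup _)
      _ = (∫ v, (v : ℝ) ∂d.law) * ε + ∫ v, ∑ j ∈ Finset.range (n + 1),
            (A (j + 1)).indicator (fun w => ε * (d.posVV w : ℝ)) v ∂d.law := by
          rw [integral_finsetSum _ hi2]
          congr 1
          refine Finset.sum_congr rfl fun j _ => ?_
          rw [integral_indicator (hAm _), integral_const_mul]
      _ ≤ _ := by
          exact add_le_add_right (integral_mono_ae (integrable_finsetSum _ hi2) hint hP2) _
  have hlim := (tendsto_invSucc.const_mul (∫ v, (v : ℝ) ∂d.law)).add_const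
    (∫ v, (d.posVV v : ℝ) * X v ∂d.law)
  rw [mul_zero, zero_add] at hlim
  exact ge_of_tendsto' hlim key

/-! ### Resampling one coordinate of the prior -/

instance {n : ℕ} (D : Fin n → ValueDist) : IsProbabilityMeasure (prior D) := by
  unfold prior
  infer_instance

theorem measurable_finset_sup {ι α δ : Type*} [MeasurableSpace α] [MeasurableSpace δ]
    [SemilatticeSup α] [OrderBot α] [MeasurableSup₂ α] (s : Finset ι) {f : ι → δ → α}
    (hf : ∀ j ∈ s, Measurable (f j)) : Measurable fun x => s.sup fun j => f j x := by
  have h : (fun x => s.sup fun j => f j x) = s.sup f := funext fun x => (Finset.sup_apply s f x).symm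
  rw [h]
  exact Finset.sup_induction (p := Measurable) measurable_const (fun _ hf _ hg => hf.sup hg) hf

section Prior

variable {n : ℕ} (D : Fin n → ValueDist) (i : Fin n)

theorem measurePreserving_eval_prior :
    MeasurePreserving (fun v : Fin n → ℝ≥0 => v i) (prior D) (D i).law :=
  measurePreserving_eval (fun i => (D i).law) i

theorem integrable_comp_eval {f : ℝ≥0 → ℝ} (hf : Integrable f (D i).law) :
    Integrable (fun v => f (v i)) (prior D) :=
  (measurePreserving_eval_prior D i).integrable_comp_of_integrable hf

/-- Overwriting a coordinate by an independent copy preserves the product law. This serves in place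
of splitting the prior into player `i` and the others, as interim quantities integrate over the
whole prior with coordinate `i` overwritten. -/
theorem measurePreserving_update :
    MeasurePreserving (fun x : (Fin n → ℝ≥0) × ℝ≥0 => Function.update x.1 i x.2)
      ((prior D).prod (D i).law) (prior D) := by
  refine ⟨measurable_update', (Measure.pi_eq fun s hs => ?_).symm⟩
  rw [Measure.map_apply measurable_update' (MeasurableSet.univ_pi hs)]
  have hpre : (fun x : (Fin n → ℝ≥0) × ℝ≥0 => Function.update x.1 i x.2) ⁻¹' Set.univ.pi s =
      (Set.univ.pi (Function.update s i Set.univ)) ×ˢ s i := by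
    ext ⟨v, b⟩
    simp only [Set.mem_preimage, Set.mem_univ_pi, Set.mem_prod]
    constructor
    · intro h
      refine ⟨fun j => ?_, by simpa using h i⟩
      rcases eq_or_ne j i with rfl | hj
      · simp
      · simpa [hj] using h j
    · rintro ⟨h, hb⟩ j
      rcases eq_or_ne j i with rfl | hj
      · simpa using hb
      · simpa [hj] using h j
  rw [hpre, Measure.prod_prod, prior, Measure.pi_pi,
    ← Finset.prod_erase_mul _ _ (Finset.mem_univ i),
    ← Finset.prod_erase_mul _ (fun j => (D j).law (s j)) (Finset.mem_univ i)]
  simp only [Function.update_self, measure_univ, mul_one]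
  congr 1
  refine Finset.prod_congr rfl fun j hj => ?_
  rw [Function.update_of_ne (Finset.ne_of_mem_erase hj)]

variable {D i} in
theorem integrable_update {f : (Fin n → ℝ≥0) → ℝ} (hf : Integrable f (prior D)) :
    Integrable (fun x : (Fin n → ℝ≥0) × ℝ≥0 => f (Function.update x.1 i x.2))
      ((prior D).prod (D i).law) :=
  (measurePreserving_update D i).integrable_comp_of_integrable hf

variable {D} in
theorem integral_prior_eq_integral_prod {f : (Fin n → ℝ≥0) → ℝ} (hf : Integrable f (prior D)) :
    ∫ v, f v ∂prior D =
      ∫ x : (Fin n → ℝ≥0) × ℝ≥0, f (Function.update x.1 i x.2) ∂((prior D).prod (D i).law) := by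
  have h := measurePreserving_update D i
  rw [← integral_map h.measurable.aemeasurable (by rw [h.map_eq]; exact hf.aestronglyMeasurable),
    h.map_eq]

/-- The positive part of the largest virtual value among the players of `A`. -/
def surplus (A : Finset (Fin n)) (v : Fin n → ℝ≥0) : ℝ≥0 := A.sup fun j => (D j).posVV (v j)

theorem surplus_le_sum (A : Finset (Fin n)) (v : Fin n → ℝ≥0) :
    (surplus D A v : ℝ) ≤ ∑ j, (v j : ℝ) := by
  rw [← NNReal.coe_sum, NNReal.coe_le_coe]
  exact Finset.sup_le fun j _ => ((D j).posVV_le _).trans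
    (Finset.single_le_sum (f := v) (fun _ _ => zero_le) (Finset.mem_univ j))

theorem measurable_surplus (A : Finset (Fin n)) : Measurable (surplus D A) := by
  exact measurable_finset_sup A fun j _ => (D j).measurable_posVV.comp (measurable_pi_apply j)

theorem integrable_sum_values : Integrable (fun v => ∑ j, (v j : ℝ)) (prior D) :=
  integrable_finsetSum _ fun j _ => integrable_comp_eval D j (D j).finiteMean

theorem integrable_surplus (A : Finset (Fin n)) :
    Integrable (fun v => (surplus D A v : ℝ)) (prior D) :=
  (integrable_sum_values D).mono' (measurable_surplus D A).coe_nnreal_real.aestronglyMeasurable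
    (Eventually.of_forall fun v => by
      rw [Real.norm_of_nonneg (NNReal.coe_nonneg _)]
      exact surplus_le_sum D A v)

end Prior

/-! ### The upper bound on the optimal revenue -/

section Bayesian

variable {n : ℕ} (M : BayesianMechanism n) (D : Fin n → ValueDist)

theorem BayesianMechanism.measurable_alloc_apply (i : Fin n) : Measurable fun v => M.alloc v i :=
  (measurable_pi_apply i).comp M.measurable_alloc

theorem BayesianMechanism.alloc_le_one (v : Fin n → ℝ≥0) (i : Fin n) : M.alloc v i ≤ 1 :=
  (Finset.single_le_sum (fun j _ => M.alloc_nonneg v j) (Finset.mem_univ i)).trans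
    (M.alloc_sum_le_one v)

theorem BayesianMechanism.norm_alloc_le (v : Fin n → ℝ≥0) (i : Fin n) : ‖M.alloc v i‖ ≤ 1 := by
  rw [Real.norm_of_nonneg (M.alloc_nonneg v i)]
  exact M.alloc_le_one v i

theorem BayesianMechanism.integrable_posVV_mul_alloc (i : Fin n) :
    Integrable (fun v => ((D i).posVV (v i) : ℝ) * M.alloc v i) (prior D) :=
  (integrable_comp_eval D i (D i).integrable_posVV).mul_bdd (c := 1)
    (M.measurable_alloc_apply i).aestronglyMeasurable
    (Eventually.of_forall fun v => M.norm_alloc_le v i)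

variable {M D}

/-- The expected payment of a player is at most his expected virtual surplus. -/
theorem BayesianMechanism.integral_pay_le (hE : M.HasExpectations D) (hIC : M.IsBIC D)
    (hIR : M.IsIR D) (i : Fin n) :
    ∫ v, M.pay v i ∂prior D ≤ ∫ v, ((D i).posVV (v i) : ℝ) * M.alloc v i ∂prior D := by
  set X : ℝ≥0 → ℝ := fun b => ∫ v, M.alloc (Function.update v i b) i ∂prior D with hX
  set P : ℝ≥0 → ℝ := fun b => ∫ v, M.pay (Function.update v i b) i ∂prior D with hP
  have hm : ∀ b, Measurable fun v => M.alloc (Function.update v i b) i := fun b =>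
    (M.measurable_alloc_apply i).comp measurable_update_left
  have hai : ∀ b, Integrable (fun v => M.alloc (Function.update v i b) i) (prior D) := fun b =>
    (integrable_const (1 : ℝ)).mono' (hm b).aestronglyMeasurable
      (Eventually.of_forall fun v => M.norm_alloc_le _ i)
  have hU : ∀ x : ℝ≥0, ∀ b ∈ (D i).law.support, M.interimUtility D i x b = x * X b - P b := by
    intro x b hb
    rw [interimUtility, integral_sub ((hai b).const_mul _) ((hE i).2 b hb), integral_const_mul]
  have hpay := integral_prior_eq_integral_prod i (hE i).1
  have hpayi := integrable_update (i := i) (hE i).1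
  have hvi := M.integrable_posVV_mul_alloc D i
  have hval := integral_prior_eq_integral_prod i hvi
  have hvali := integrable_update (i := i) hvi
  rw [hpay, hval, integral_prod_symm _ hpayi, integral_prod_symm _ hvali]
  simp only [Function.update_self, integral_const_mul]
  have hallI : Integrable (fun x : (Fin n → ℝ≥0) × ℝ≥0 =>
      M.alloc (Function.update x.1 i x.2) i) ((prior D).prod (D i).law) :=
    integrable_update ((integrable_const (1 : ℝ)).mono'
      (M.measurable_alloc_apply i).aestronglyMeasurable
      (Eventually.of_forall fun v => M.norm_alloc_le _ i))
  refine (D i).integral_payment_le (X := X) (P := P) hallI.integral_prod_right.aestronglyMeasurable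
    hpayi.integral_prod_right (fun b _ => integral_nonneg fun v => M.alloc_nonneg _ i)
    (fun b _ => ?_) (fun x hx b hb => ?_) fun x hx => ?_
  · have := integral_mono (hai b) (integrable_const (1 : ℝ)) fun v => M.alloc_le_one _ i
    simpa using this
  · rw [← hU x b hb, ← hU x x hx]
    exact hIC i x hx b hb
  · rw [← hU x x hx]
    exact hIR i x hx

/-- Pointwise, allocation probabilities of total at most 1 cannot collect more than the largest
positive virtual value. -/
theorem BayesianMechanism.revenue_le (hE : M.HasExpectations D) (hIC : M.IsBIC D)
    (hIR : M.IsIR D) : M.revenue D ≤ ∫ v, (surplus D Finset.univ v : ℝ) ∂prior D := by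
  rw [revenue, integral_finsetSum _ fun i _ => (hE i).1]
  refine (Finset.sum_le_sum fun i _ => integral_pay_le hE hIC hIR i).trans ?_
  have hi : ∀ i ∈ Finset.univ,
      Integrable (fun v => ((D i).posVV (v i) : ℝ) * M.alloc v i) (prior D) := fun i _ =>
    M.integrable_posVV_mul_alloc D i
  rw [← integral_finsetSum _ hi]
  refine integral_mono (integrable_finsetSum _ hi) (integrable_surplus D _) fun v => ?_
  calc ∑ i, ((D i).posVV (v i) : ℝ) * M.alloc v i
      ≤ ∑ i, (surplus D Finset.univ v : ℝ) * M.alloc v i := by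
        refine Finset.sum_le_sum fun i _ => mul_le_mul_of_nonneg_right ?_ (M.alloc_nonneg v i)
        exact NNReal.coe_le_coe.2
          (Finset.le_sup (f := fun j => (D j).posVV (v j)) (Finset.mem_univ i))
    _ = (surplus D Finset.univ v : ℝ) * ∑ i, M.alloc v i := by rw [Finset.mul_sum]
    _ ≤ _ := mul_le_of_le_one_right (NNReal.coe_nonneg _) (M.alloc_sum_le_one v)

variable (D) in
/-- The optimal revenue is at most the expected virtual surplus. -/
theorem OPT_le : OPT D ≤ ((∫ v, (surplus D Finset.univ v : ℝ) ∂prior D : ℝ) : EReal) :=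
  iSup₂_le fun _ h => EReal.coe_le_coe_iff.2 (BayesianMechanism.revenue_le h.1 h.2.1 h.2.2)

end Bayesian

variable {n : ℕ}

/-! ### Lexicographic comparison of scores -/

/-- Player `i` precedes player `j` in the order by scores, ties broken lexicographically. -/
def Beats (w : Fin n → EReal) (i j : Fin n) : Prop := w j < w i ∨ w j = w i ∧ i < j

theorem Beats.trans {w : Fin n → EReal} {i j k : Fin n} (h1 : Beats w i j) (h2 : Beats w j k) :
    Beats w i k := by
  rcases h1 with h1 | ⟨h1, h1'⟩ <;> rcases h2 with h2 | ⟨h2, h2'⟩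
  · exact Or.inl (h2.trans h1)
  · exact Or.inl (h2 ▸ h1)
  · exact Or.inl (h1 ▸ h2)
  · exact Or.inr ⟨h2.trans h1, h1'.trans h2'⟩

theorem Beats.asymm {w : Fin n → EReal} {i j : Fin n} (h1 : Beats w i j) : ¬ Beats w j i := by
  rintro (h2 | ⟨h2, h2'⟩) <;> rcases h1 with h1 | ⟨h1, h1'⟩
  · exact lt_asymm h1 h2
  · exact h2.ne h1.symm
  · exact h1.ne h2.symm
  · exact lt_asymm h1' h2'

theorem Beats.congr {w w' : Fin n → EReal} {i j : Fin n} (h : Beats w i j) (hi : w i = w' i)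
    (hj : w j = w' j) : Beats w' i j := by
  unfold Beats at *
  rwa [← hi, ← hj]

theorem top_mem (w : Fin n → EReal) {S : Finset (Fin n)} (h : S.Nonempty) : top w S h ∈ S :=
  (Finset.mem_filter.1 (Finset.min'_mem _ (leaders_nonempty w h))).1

theorem top_beats (w : Fin n → EReal) {S : Finset (Fin n)} (h : S.Nonempty) {j : Fin n}
    (hj : j ∈ S) (hne : j ≠ top w S h) : Beats w (top w S h) j := by
  have hmem := (Finset.mem_filter.1 (Finset.min'_mem _ (leaders_nonempty w h))).2
  rcases (hmem j hj).lt_or_eq with hlt | heq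
  · exact Or.inl hlt
  · refine Or.inr ⟨heq, lt_of_le_of_ne (Finset.min'_le _ j (Finset.mem_filter.2 ⟨hj, ?_⟩)) hne.symm⟩
    intro k hk
    rw [heq]
    exact hmem k hk

theorem top_eq {w : Fin n → EReal} {S : Finset (Fin n)} (h : S.Nonempty) {i : Fin n} (hi : i ∈ S)
    (hb : ∀ j ∈ S, j ≠ i → Beats w i j) : top w S h = i := by
  by_contra hne
  exact (hb _ (top_mem w h) hne).asymm (top_beats w h hi (Ne.symm hne))

theorem top_congr {w w' : Fin n → EReal} {S : Finset (Fin n)} (h : S.Nonempty)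
    (hw : ∀ j ∈ S, w j = w' j) : top w S h = top w' S h :=
  top_eq h (top_mem w' h) fun j hj hne =>
    (top_beats w' h hj hne).congr (hw _ (top_mem w' h)).symm (hw j hj).symm

theorem score_eq_of_some {s : Fin n → Report n} {K : Knowledge n} {j : Fin n} {d : ValueDist}
    (h : K j = some d) : score s K j = d.virtualValue (s j).value := by
  unfold score
  rw [h]

theorem score_congr {s s' : Fin n → Report n} {K K' : Knowledge n} {j : Fin n} (hs : s j = s' j)
    (hK : K j = K' j) : score s K j = score s' K' j := by
  unfold score
  rw [hs, hK]

/-! ### The threshold set -/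

/-- The values with which player `i` wins against the players of `R` with scores `w`. -/
def winSet (d : ValueDist) (R : Finset (Fin n)) (w : Fin n → EReal) (i : Fin n) : Set ℝ≥0 :=
  {x | 0 ≤ d.virtualValue x ∧
    ∀ j ∈ R, w j < d.virtualValue x ∨ w j = d.virtualValue x ∧ i < j}

theorem isUpperSet_winSet (d : ValueDist) (R : Finset (Fin n)) (w : Fin n → EReal) (i : Fin n) :
    IsUpperSet (winSet d R w i) := by
  intro x y hxy hx
  have hm := d.virtualValue_mono hxy
  refine ⟨hx.1.trans hm, fun j hj => ?_⟩
  rcases hm.lt_or_eq with hlt | heq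
  · rcases hx.2 j hj with h | h
    · exact Or.inl (h.trans hlt)
    · exact Or.inl (h.1.trans_lt hlt)
  · rw [← heq]
    exact hx.2 j hj

theorem winSet_congr (d : ValueDist) {R : Finset (Fin n)} {w w' : Fin n → EReal} (i : Fin n)
    (h : ∀ j ∈ R, w j = w' j) : winSet d R w i = winSet d R w' i := by
  ext x
  refine and_congr_right fun _ => forall₂_congr fun j hj => ?_
  rw [h j hj]

/-- Reconciles pairwise comparison with the rivals and the second-highest score used in the
mechanism's price. -/
theorem mem_winSet_iff {d : ValueDist} {R : Finset (Fin n)} {w : Fin n → EReal} {i : Fin n}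
    {x : ℝ≥0} : x ∈ winSet d R w i ↔ max (R.sup w) 0 ≤ d.virtualValue x ∧
      (d.virtualValue x = R.sup w → ∀ j ∈ R, w j = R.sup w → i < j) := by
  simp only [winSet, max_le_iff, Finset.sup_le_iff]
  constructor
  · rintro ⟨h1, h2⟩
    refine ⟨⟨fun j hj => (h2 j hj).elim le_of_lt fun h => h.1.le, h1⟩, fun hx j hj hj' => ?_⟩
    rcases h2 j hj with h | h
    · exact absurd (hj'.trans hx.symm) h.ne
    · exact h.2
  · rintro ⟨⟨h1, h2⟩, h3⟩
    refine ⟨h2, fun j hj => (h1 j hj).lt_or_eq.imp id fun heq => ⟨heq, ?_⟩⟩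
    have hs : R.sup w = d.virtualValue x :=
      le_antisymm (Finset.sup_le h1) (heq ▸ Finset.le_sup hj)
    exact h3 hs.symm j hj (heq.trans hs.symm)

theorem thresholdPrice_eq (s : Fin n → Report n) (a : Fin n) (σ : State n) (d : ValueDist) :
    thresholdPrice s a σ d = sInf (winSet d (rivals a σ) (score s σ.D') σ.star) := by
  unfold thresholdPrice
  exact congrArg sInf (Set.ext fun x => mem_winSet_iff.symm)

/-! ### Runs of the mechanism -/

/-- The state with given current set, uncollected players and collected distributions. -/
def startState (s : Fin n → Report n) (S rest : Finset (Fin n)) (K : Knowledge n)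
    (h : S.Nonempty) : State n :=
  { S := S, rest := rest, star := top (score s K) S h, D' := K }

/-- The collected distributions after one more round. -/
def nextDist (s : Fin n → Report n) (σ : State n) : Knowledge n :=
  fun j => if j ∈ discovered s σ then firstReport s σ j else σ.D' j

theorem next_eq (s : Fin n → Report n) (σ : State n) :
    next s σ = startState s (insert σ.star (discovered s σ)) (σ.rest \ discovered s σ)
      (nextDist s σ) (Finset.insert_nonempty _ _) := rfl

theorem discovered_subset (s : Fin n → Report n) (σ : State n) : discovered s σ ⊆ σ.rest :=
  Finset.filter_subset _ _

theorem collect_of_nonempty {s : Fin n → Report n} {σ : State n}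
    (h : (discovered s σ).Nonempty) : collect s σ = collect s (next s σ) := by
  rw [collect, if_pos h]

theorem collect_of_not_nonempty {s : Fin n → Report n} {σ : State n}
    (h : ¬ (discovered s σ).Nonempty) : collect s σ = σ := by
  rw [collect, if_neg h]

/-- What holds initially and is preserved by each round holds at the end of the loop. -/
theorem collect_induction {s : Fin n → Report n} {p : State n → Prop}
    (hp : ∀ σ, p σ → (discovered s σ).Nonempty → p (next s σ)) (σ : State n) (h : p σ) :
    p (collect s σ) := by
  induction σ using collect.induct s with
  | case1 σ hne ih =>
    rw [collect_of_nonempty hne]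
    exact ih (hp σ h hne)
  | case2 σ hne => rwa [collect_of_not_nonempty hne]

theorem discovered_collect (s : Fin n → Report n) (σ : State n) :
    ¬ (discovered s (collect s σ)).Nonempty := by
  induction σ using collect.induct s with
  | case1 σ hne ih => rwa [collect_of_nonempty hne]
  | case2 σ hne => rwa [collect_of_not_nonempty hne]

/-- The standing facts about the states of a run with excluded player `a`. -/
structure WellFormed (a : Fin n) (s : Fin n → Report n) (σ : State n) : Prop where
  notMem : a ∉ σ.S
  star_mem : σ.star ∈ σ.S
  disjoint : ∀ j ∈ σ.S, j ∉ σ.rest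
  notMem_rest : a ∉ σ.rest
  beats : ∀ j, j ∉ σ.rest → j ≠ a → j ≠ σ.star → Beats (score s σ.D') σ.star j

theorem nextDist_of_notMem {s : Fin n → Report n} {σ : State n} {j : Fin n} (h : j ∉ σ.rest) :
    nextDist s σ j = σ.D' j :=
  if_neg fun hj => h (discovered_subset s σ hj)

/-- Dropped players were beaten by the old leader, who either stays in front or is beaten by the new
one; scores of collected players do not change, so transitivity suffices. -/
theorem WellFormed.next {a : Fin n} {s : Fin n → Report n} {σ : State n}
    (h : WellFormed a s σ) : WellFormed a s (next s σ) := by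
  rw [next_eq]
  set S' := discovered s σ
  have hS' : S' ⊆ σ.rest := discovered_subset s σ
  have hstar : σ.star ∉ σ.rest := h.disjoint _ h.star_mem
  refine ⟨?_, top_mem _ (Finset.insert_nonempty _ _), ?_, ?_, ?_⟩
  · change a ∉ insert σ.star S'
    rw [Finset.mem_insert, not_or]
    exact ⟨fun hh => h.notMem (hh ▸ h.star_mem), fun hh => h.notMem_rest (hS' hh)⟩
  · intro j hj hjr
    have hjr' := Finset.mem_sdiff.1 hjr
    rcases Finset.mem_insert.1 hj with rfl | hj
    · exact hstar hjr'.1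
    · exact hjr'.2 hj
  · exact fun hh => h.notMem_rest (Finset.mem_sdiff.1 hh).1
  · intro j hjr hja hjs
    change Beats (score s (nextDist s σ)) (top (score s (nextDist s σ)) (insert σ.star S')
      (Finset.insert_nonempty _ _)) j
    by_cases hj : j ∈ insert σ.star S'
    · exact top_beats _ _ hj hjs
    · rw [Finset.mem_insert, not_or] at hj
      have hjr' : j ∉ σ.rest := fun hh => hjr (Finset.mem_sdiff.2 ⟨hh, hj.2⟩)
      have hb : Beats (score s (nextDist s σ)) σ.star j :=
        (h.beats j hjr' hja hj.1).congr (score_congr rfl (nextDist_of_notMem hstar).symm)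
          (score_congr rfl (nextDist_of_notMem hjr').symm)
      by_cases hst : σ.star = top (score s (nextDist s σ)) (insert σ.star S')
          (Finset.insert_nonempty _ _)
      · exact hst ▸ hb
      · exact (top_beats _ _ (Finset.mem_insert_self _ _) hst).trans hb

theorem WellFormed.collect {a : Fin n} {s : Fin n → Report n} {σ : State n}
    (h : WellFormed a s σ) : WellFormed a s (collect s σ) :=
  collect_induction (fun _ h _ => h.next) σ h

theorem WellFormed.mem_rivals {a : Fin n} {σ : State n} {j : Fin n} :
    j ∈ rivals a σ ↔ j ∉ σ.rest ∧ j ≠ a ∧ j ≠ σ.star := by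
  simp only [rivals, Finset.mem_sdiff, Finset.mem_univ, true_and, Finset.mem_union,
    Finset.mem_insert, Finset.mem_singleton]
  tauto

/-- What has been collected about a player is never changed. -/
theorem collect_keeps {s : Fin n → Report n} (σ : State n) {j : Fin n} (h : j ∉ σ.rest) :
    j ∉ (collect s σ).rest ∧ (collect s σ).D' j = σ.D' j := by
  refine collect_induction (p := fun τ => j ∉ τ.rest ∧ τ.D' j = σ.D' j) ?_ σ ⟨h, rfl⟩
  rintro τ ⟨h1, h2⟩ -
  rw [next_eq]
  exact ⟨fun hh => h1 (Finset.mem_sdiff.1 hh).1, (nextDist_of_notMem h1).trans h2⟩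

/-- A collected player who is not in front never gets in front. -/
theorem collect_star_ne {s : Fin n → Report n} (σ : State n) {j : Fin n} (h : j ∉ σ.rest)
    (hne : σ.star ≠ j) : (collect s σ).star ≠ j := by
  refine (collect_induction (p := fun τ => j ∉ τ.rest ∧ τ.star ≠ j) ?_ σ ⟨h, hne⟩).2
  rintro τ ⟨h1, h2⟩ -
  rw [next_eq]
  refine ⟨fun hh => h1 (Finset.mem_sdiff.1 hh).1, fun hh => ?_⟩
  have hmem : j ∈ insert τ.star (discovered s τ) := hh ▸ top_mem _ (Finset.insert_nonempty _ _)
  rcases Finset.mem_insert.1 hmem with rfl | hmem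
  · exact h2 rfl
  · exact h1 (discovered_subset s τ hmem)

theorem discovered_congr {i : Fin n} {s s' : Fin n → Report n} (hs : ∀ j, j ≠ i → s j = s' j)
    {σ : State n} (hi : i ∉ σ.S.erase σ.star) : discovered s σ = discovered s' σ := by
  refine Finset.filter_congr fun j _ => exists_congr fun k => and_congr_right fun hk => ?_
  rw [hs k fun h => hi (h ▸ hk)]

theorem firstReport_congr {i : Fin n} {s s' : Fin n → Report n} (hs : ∀ j, j ≠ i → s j = s' j)
    {σ : State n} (hi : i ∉ σ.S.erase σ.star) (j : Fin n) :
    firstReport s σ j = firstReport s' σ j := by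
  unfold firstReport
  congr 1
  funext k
  by_cases hk : k ∈ σ.S.erase σ.star
  · rw [if_pos hk, if_pos hk, hs k fun h => hi (h ▸ hk)]
  · rw [if_neg hk, if_neg hk]

/-- A player who ends up in front does not influence the run: another report of his leads to the
same final state if it also puts him in front, in particular if it beats all the rivals. -/
theorem collect_startState_eq {i a : Fin n} {s s' : Fin n → Report n}
    (hs : ∀ j, j ≠ i → s j = s' j) (S rest : Finset (Fin n)) (K : Knowledge n) (h : S.Nonempty)
    (hi : i ∈ S ∨ i ∈ rest) (hdisj : ∀ j ∈ S, j ∉ rest) (haS : a ∉ S) (har : a ∉ rest)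
    (hstar : (collect s (startState s S rest K h)).star = i)
    (hother : (collect s' (startState s' S rest K h)).star = i ∨
      ∀ j, j ∉ (collect s (startState s S rest K h)).rest → j ≠ i → j ≠ a →
        Beats (score s' (collect s (startState s S rest K h)).D') i j) :
    collect s' (startState s' S rest K h) = collect s (startState s S rest K h) := by
  induction hm : rest.card using Nat.strong_induction_on generalizing S rest K with
  | _ m ih =>
  set σ := startState s S rest K h with hσ
  -- A collected player who ends in front must be in front already.
  have hstart : i ∈ S → σ.star = i := by
    intro hiS
    by_contra hne
    exact collect_star_ne σ (hdisj i hiS) hne hstar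
  have hσ' : startState s' S rest K h = σ := by
    have : top (score s' K) S h = top (score s K) S h := by
      by_cases hiS : i ∈ S
      · rw [show top (score s K) S h = i from hstart hiS]
        rcases hother with hother | hother
        · by_contra hne
          exact collect_star_ne _ (hdisj i hiS) hne hother
        · refine top_eq h hiS fun j hj hne => ?_
          have hki := collect_keeps (s := s) σ (hdisj i hiS)
          have hkj := collect_keeps (s := s) σ (hdisj j hj)
          exact (hother j hkj.1 hne fun hja => haS (hja ▸ hj)).congr
            (score_congr rfl hki.2) (score_congr rfl hkj.2)
      · exact top_congr h fun j hj =>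
          (score_congr (hs j fun hji => hiS (hji ▸ hj)) rfl).symm
    simp only [hσ, startState, this]
  rw [hσ'] at hother ⊢
  -- Consequently `i` is never among those whose knowledge is consulted, and the round is the same
  -- under both profiles.
  have hi' : i ∉ σ.S.erase σ.star := fun hh =>
    (Finset.mem_erase.1 hh).1 (hstart (Finset.mem_erase.1 hh).2).symm
  have hd := discovered_congr hs hi'
  by_cases hne : (discovered s σ).Nonempty
  · have hne' : (discovered s' σ).Nonempty := hd ▸ hne
    have hK : nextDist s' σ = nextDist s σ := by
      funext j
      unfold nextDist
      rw [hd, firstReport_congr hs hi']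
    have hnext' : next s' σ = startState s' (insert σ.star (discovered s σ))
        (σ.rest \ discovered s σ) (nextDist s σ) (Finset.insert_nonempty _ _) := by
      rw [next_eq]
      simp only [hK, hd]
    rw [collect_of_nonempty hne, next_eq] at hstar hother ⊢
    rw [collect_of_nonempty hne', hnext'] at hother ⊢
    have hsub : discovered s σ ⊆ rest := discovered_subset s σ
    have hstarS : σ.star ∈ S := top_mem _ h
    refine ih _ ?_ _ _ _ _ ?_ ?_ ?_ ?_ hstar hother rfl
    · rw [← hm]
      obtain ⟨j, hj⟩ := hne
      exact Finset.card_lt_card (Finset.sdiff_ssubset hsub ⟨j, hj⟩)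
    · rcases hi with hi | hi
      · exact Or.inl (Finset.mem_insert.2 (Or.inl (hstart hi).symm))
      · by_cases hid : i ∈ discovered s σ
        · exact Or.inl (Finset.mem_insert_of_mem hid)
        · exact Or.inr (Finset.mem_sdiff.2 ⟨hi, hid⟩)
    · intro j hj hjr
      rcases Finset.mem_insert.1 hj with rfl | hj
      · exact hdisj _ hstarS (Finset.mem_sdiff.1 hjr).1
      · exact (Finset.mem_sdiff.1 hjr).2 hj
    · rw [Finset.mem_insert, not_or]
      exact ⟨fun hh => haS (hh ▸ hstarS), fun hh => har (hsub hh)⟩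
    · exact fun hh => har (Finset.mem_sdiff.1 hh).1
  · have hne' : ¬ (discovered s' σ).Nonempty := hd ▸ hne
    rw [collect_of_not_nonempty hne, collect_of_not_nonempty hne']

/-! ### Winning -/

/-- The final state of the run with excluded player `a`. -/
def finalState (s : Fin n → Report n) (a : Fin n) (h : (initialSet s a).Nonempty) : State n :=
  collect s (startState s (initialSet s a) (Finset.univ \ ({a} ∪ initialSet s a))
    (initialDist s a) h)

theorem csmOutcome_eq {s : Fin n → Report n} {a : Fin n} (h : (initialSet s a).Nonempty) :
    csmOutcome a s = finish s a (finalState s a h) := by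
  unfold csmOutcome
  rw [dif_pos h]
  rfl

theorem notMem_initialSet (s : Fin n → Report n) (a : Fin n) : a ∉ initialSet s a := by
  unfold initialSet initialDist
  rw [Finset.mem_filter]
  simp

theorem wellFormed_start (s : Fin n → Report n) (a : Fin n) (h : (initialSet s a).Nonempty) :
    WellFormed a s (startState s (initialSet s a) (Finset.univ \ ({a} ∪ initialSet s a))
      (initialDist s a) h) where
  notMem := notMem_initialSet s a
  star_mem := top_mem _ h
  disjoint j hj hjr :=
    (Finset.mem_sdiff.1 hjr).2 (Finset.mem_union_right _ hj)
  notMem_rest ha :=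
    (Finset.mem_sdiff.1 ha).2 (Finset.mem_union_left _ (Finset.mem_singleton_self a))
  beats j hjr hja hjs := by
    refine top_beats _ h ?_ hjs
    by_contra hj
    refine hjr (Finset.mem_sdiff.2 ⟨Finset.mem_univ j, ?_⟩)
    rw [Finset.mem_union, Finset.mem_singleton, not_or]
    exact ⟨hja, hj⟩

theorem wellFormed_finalState (s : Fin n → Report n) (a : Fin n)
    (h : (initialSet s a).Nonempty) : WellFormed a s (finalState s a h) :=
  (wellFormed_start s a h).collect

/-- Player `i` wins for the reports `s` when `a` is excluded, and pays the threshold of `W`. -/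
structure WinsWith (a i : Fin n) (s : Fin n → Report n) (W : Set ℝ≥0) : Prop where
  winner : (csmOutcome a s).winner = some i
  price : (csmOutcome a s).price = Pi.single i ((sInf W : ℝ≥0) : ℝ)
  upper : IsUpperSet W
  mem : (s i).value ∈ W
  mem_iff : ∀ s', (∀ j, j ≠ i → s j = s' j) →
    ((csmOutcome a s').winner = some i ↔ (s' i).value ∈ W) ∧
    ((csmOutcome a s').winner = some i →
      (csmOutcome a s').price = Pi.single i ((sInf W : ℝ≥0) : ℝ))

theorem finish_cases (s : Fin n → Report n) (a : Fin n) (σ : State n) :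
    (finish s a σ = ⟨none, 0⟩ ∧
      ∀ d, σ.D' σ.star = some d → d.virtualValue (s σ.star).value < 0) ∨
    ∃ d, σ.D' σ.star = some d ∧ 0 ≤ d.virtualValue (s σ.star).value ∧
      finish s a σ = ⟨some σ.star, Pi.single σ.star
        ((sInf (winSet d (rivals a σ) (score s σ.D') σ.star) : ℝ≥0) : ℝ)⟩ := by
  cases hd : σ.D' σ.star with
  | none =>
    left
    refine ⟨?_, by simp⟩
    unfold finish
    rw [hd]
  | some d =>
    have hf : finish s a σ = if d.virtualValue (s σ.star).value < 0 then ⟨none, 0⟩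
        else ⟨some σ.star, Pi.single σ.star ((thresholdPrice s a σ d : ℝ≥0) : ℝ)⟩ := by
      unfold finish
      rw [hd]
    by_cases hneg : d.virtualValue (s σ.star).value < 0
    · left
      refine ⟨by rw [hf, if_pos hneg], ?_⟩
      rintro _ ⟨⟩
      exact hneg
    · right
      refine ⟨d, rfl, not_lt.1 hneg, ?_⟩
      rw [hf, if_neg hneg, thresholdPrice_eq]

/-- Whoever does not win pays nothing. -/
theorem price_eq_zero {a i : Fin n} {s : Fin n → Report n}
    (h : (csmOutcome a s).winner ≠ some i) : (csmOutcome a s).price i = 0 := by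
  by_cases hne : (initialSet s a).Nonempty
  · rw [csmOutcome_eq hne] at h ⊢
    rcases finish_cases s a (finalState s a hne) with ⟨h', -⟩ | ⟨d, -, -, h'⟩
    · rw [h']
      rfl
    · rw [h'] at h ⊢
      exact Pi.single_eq_of_ne (fun hh => h (by rw [hh])) _
  · unfold csmOutcome
    rw [dif_neg hne]
    rfl

theorem WellFormed.mem_winSet {a : Fin n} {s : Fin n → Report n} {σ : State n}
    (h : WellFormed a s σ) {d : ValueDist} (hd : σ.D' σ.star = some d)
    (h0 : 0 ≤ d.virtualValue (s σ.star).value) :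
    (s σ.star).value ∈ winSet d (rivals a σ) (score s σ.D') σ.star := by
  refine ⟨h0, fun j hj => ?_⟩
  obtain ⟨h1, h2, h3⟩ := mem_rivals.1 hj
  have := h.beats j h1 h2 h3
  unfold Beats at this
  rwa [score_eq_of_some hd] at this

theorem initialDist_congr {a i : Fin n} {s s' : Fin n → Report n}
    (hs : ∀ j, j ≠ i → s j = s' j) (hai : a ≠ i) : initialDist s' a = initialDist s a := by
  funext j
  unfold initialDist
  rw [hs a hai]

theorem initialSet_congr {a i : Fin n} {s s' : Fin n → Report n}
    (hs : ∀ j, j ≠ i → s j = s' j) (hai : a ≠ i) : initialSet s' a = initialSet s a := by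
  unfold initialSet
  rw [initialDist_congr hs hai]

/-- `W` is the win set against the rivals in the final state. Any other report of `i` that wins, or
whose value lies in `W`, leads to this same final state, so neither rivals nor price depend on what
`i` reports. -/
theorem exists_winsWith {a i : Fin n} {s : Fin n → Report n}
    (h : (csmOutcome a s).winner = some i) : ∃ W, WinsWith a i s W := by
  have hne : (initialSet s a).Nonempty := by
    by_contra hne
    unfold csmOutcome at h
    rw [dif_neg hne] at h
    cases h
  have hout := csmOutcome_eq hne
  have hwf := wellFormed_finalState s a hne
  set σ := finalState s a hne with hσ
  rcases finish_cases s a σ with ⟨h', -⟩ | ⟨d, hd, h0, h'⟩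
  · rw [hout, h'] at h
    cases h
  rw [← hout] at h'
  have hstar : σ.star = i := by
    rw [h'] at h
    exact Option.some.inj h
  have hai : a ≠ i := by
    rintro rfl
    exact hwf.notMem (hstar ▸ hwf.star_mem)
  have hmem := hwf.mem_winSet hd h0
  refine ⟨winSet d (rivals a σ) (score s σ.D') σ.star, h, by rw [h', hstar],
    isUpperSet_winSet _ _ _ _, by rwa [hstar] at hmem ⊢, fun s' hs => ?_⟩
  have hset := initialSet_congr hs hai
  have hne' : (initialSet s' a).Nonempty := hset ▸ hne
  have hfin' : finalState s' a hne' = collect s' (startState s' (initialSet s a)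
      (Finset.univ \ ({a} ∪ initialSet s a)) (initialDist s a) hne) := by
    unfold finalState
    simp only [hset, initialDist_congr hs hai]
  have hst := wellFormed_start s a hne
  have hi : i ∈ initialSet s a ∨ i ∈ Finset.univ \ ({a} ∪ initialSet s a) := by
    by_cases hiS : i ∈ initialSet s a
    · exact Or.inl hiS
    · right
      simp [hiS, hai.symm]
  have hrun := collect_startState_eq hs (initialSet s a) (Finset.univ \ ({a} ∪ initialSet s a))
    (initialDist s a) hne hi hst.disjoint hst.notMem hst.notMem_rest hstar
  rw [← hfin'] at hrun
  change (_ ∨ ∀ j, j ∉ σ.rest → j ≠ i → j ≠ a → Beats (score s' σ.D') i j) →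
    finalState s' a hne' = σ at hrun
  have hd' : σ.D' i = some d := hstar ▸ hd
  have hscore : ∀ j ∈ rivals a σ, score s' σ.D' j = score s σ.D' j := fun j hj =>
    (score_congr (hs j (hstar ▸ (WellFormed.mem_rivals.1 hj).2.2)) rfl).symm
  have hout' := csmOutcome_eq hne'
  -- with a final state as for `s`, the two outcomes are computed from the same data
  have hsame : finalState s' a hne' = σ → 0 ≤ d.virtualValue (s' i).value →
      csmOutcome a s' = ⟨some i, Pi.single i
        ((sInf (winSet d (rivals a σ) (score s σ.D') σ.star) : ℝ≥0) : ℝ)⟩ := by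
    intro hfs hpos
    rw [hout', hfs]
    rcases finish_cases s' a σ with ⟨-, hneg⟩ | ⟨d', hdd, -, heq⟩
    · refine absurd (hneg d hd) (not_lt.2 ?_)
      rwa [hstar]
    · obtain rfl : d = d' := Option.some.inj (hd.symm.trans hdd)
      rw [heq, winSet_congr d σ.star hscore, hstar]
  have hwin : (csmOutcome a s').winner = some i →
      finalState s' a hne' = σ ∧ 0 ≤ d.virtualValue (s' i).value := by
    intro hw
    rw [hout'] at hw
    rcases finish_cases s' a (finalState s' a hne') with ⟨hnone, -⟩ | ⟨d', hdd, hpos, heq⟩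
    · rw [hnone] at hw
      cases hw
    · rw [heq] at hw
      have hstar' : (finalState s' a hne').star = i := Option.some.inj hw
      have hfs := hrun (Or.inl hstar')
      refine ⟨hfs, ?_⟩
      rw [hfs] at hdd hpos
      rw [hstar] at hdd hpos
      obtain rfl : d = d' := Option.some.inj (hd'.symm.trans hdd)
      exact hpos
  refine ⟨⟨fun hw => ?_, fun hx => ?_⟩, fun hw => ?_⟩
  · obtain ⟨hfs, hpos⟩ := hwin hw
    have hwf' := wellFormed_finalState s' a hne'
    rw [hfs] at hwf'
    have := hwf'.mem_winSet hd (by rwa [hstar])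
    rw [winSet_congr d σ.star hscore] at this
    rwa [hstar] at this ⊢
  · have hfs := hrun (Or.inr fun j hjr hji hja => by
      have hj : j ∈ rivals a σ := WellFormed.mem_rivals.2 ⟨hjr, hja, hstar ▸ hji⟩
      have := hx.2 j hj
      rw [← hscore j hj, hstar] at this
      unfold Beats
      rwa [score_eq_of_some hd'])
    rw [hsame hfs hx.1]
  · obtain ⟨hfs, hpos⟩ := hwin hw
    rw [hsame hfs hpos]

/-! ### Truthfulness -/

theorem utility_of_winsWith {a i : Fin n} {s : Fin n → Report n} {W : Set ℝ≥0}
    (h : WinsWith a i s W) (v : ℝ≥0) :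
    (csmOutcome a s).utility i v = (v : ℝ) - ((sInf W : ℝ≥0) : ℝ) := by
  rw [Outcome.utility, if_pos h.winner, h.price, Pi.single_eq_same]

theorem utility_of_not_winner {a i : Fin n} {s : Fin n → Report n}
    (h : (csmOutcome a s).winner ≠ some i) (v : ℝ≥0) : (csmOutcome a s).utility i v = 0 := by
  rw [Outcome.utility, if_neg h, price_eq_zero h, sub_zero]

/-- Another report of the winner has the outcome determined by the threshold. -/
theorem WinsWith.utility_other {a i : Fin n} {s s' : Fin n → Report n} {W : Set ℝ≥0}
    (h : WinsWith a i s W) (hs : ∀ j, j ≠ i → s j = s' j) (hmem : (s' i).value ∈ W) (v : ℝ≥0) :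
    (csmOutcome a s').utility i v = (v : ℝ) - ((sInf W : ℝ≥0) : ℝ) := by
  have hw := (h.mem_iff s' hs).1.2 hmem
  rw [Outcome.utility, if_pos hw, (h.mem_iff s' hs).2 hw, Pi.single_eq_same]

theorem sInf_le_of_mem {W : Set ℝ≥0} {x : ℝ≥0} (h : x ∈ W) :
    ((sInf W : ℝ≥0) : ℝ) ≤ x :=
  NNReal.coe_le_coe.2 (csInf_le (OrderBot.bddBelow W) h)

/-- With a truthfully reported value, the utility is between zero and the value. -/
theorem utility_mem_Icc (a i : Fin n) (s : Fin n → Report n) :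
    0 ≤ (csmOutcome a s).utility i (s i).value ∧
      (csmOutcome a s).utility i (s i).value ≤ (s i).value := by
  by_cases hw : (csmOutcome a s).winner = some i
  · obtain ⟨W, hW⟩ := exists_winsWith hw
    rw [utility_of_winsWith hW]
    have h1 := sInf_le_of_mem hW.mem
    have h2 : (0 : ℝ) ≤ ((sInf W : ℝ≥0) : ℝ) := NNReal.coe_nonneg _
    constructor <;> linarith
  · rw [utility_of_not_winner hw]
    exact ⟨le_rfl, NNReal.coe_nonneg _⟩

/-- The true value is that in `s'`. If the deviation `s` wins, either the true value passes the same
threshold or it is at most the price. The knowledge of `i` may differ as well, so this serves both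
truthfulness requirements. -/
theorem utility_le_truthful {a i : Fin n} {s s' : Fin n → Report n}
    (hs : ∀ j, j ≠ i → s j = s' j) :
    (csmOutcome a s).utility i (s' i).value ≤ (csmOutcome a s').utility i (s' i).value := by
  by_cases hw : (csmOutcome a s).winner = some i
  · obtain ⟨W, hW⟩ := exists_winsWith hw
    rw [utility_of_winsWith hW]
    by_cases hmem : (s' i).value ∈ W
    · rw [hW.utility_other hs hmem]
    · have hle : (s' i).value ≤ sInf W := by
        refine le_csInf ⟨_, hW.mem⟩ fun x hx => ?_
        by_contra! hlt
        exact hmem (hW.upper hlt.le hx)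
      have hle' : ((s' i).value : ℝ) ≤ ((sInf W : ℝ≥0) : ℝ) := NNReal.coe_le_coe.2 hle
      linarith [(utility_mem_Icc a i s').1]
  · rw [utility_of_not_winner hw]
    exact (utility_mem_Icc a i s').1

/-- The knowledge reported by a player does not affect his own utility. -/
theorem utility_eq_of_value_eq {a i : Fin n} {s s' : Fin n → Report n}
    (hs : ∀ j, j ≠ i → s j = s' j) (hv : (s i).value = (s' i).value) :
    (csmOutcome a s).utility i (s i).value = (csmOutcome a s').utility i (s i).value := by
  refine le_antisymm ?_ (utility_le_truthful fun j hj => (hs j hj).symm)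
  rw [hv]
  exact utility_le_truthful hs

theorem valueTruthful_csm (n : ℕ) [NeZero n] : ValueTruthful (csm n) := by
  intro i v b K s
  refine Finset.sum_le_sum fun a _ => mul_le_mul_of_nonneg_left ?_ ENNReal.toReal_nonneg
  have := utility_le_truthful (a := a) (i := i) (s := Function.update s i ⟨b, K⟩)
    (s' := Function.update s i ⟨v, K⟩) fun j hj => by
      rw [Function.update_of_ne hj, Function.update_of_ne hj]
  rwa [Function.update_self] at this

theorem coinLaw_csm (n : ℕ) [NeZero n] (a : Fin n) :
    ((csm n).coinLaw a).toReal = 1 / (n : ℝ) := by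
  change ((PMF.uniformOfFintype (Fin n)) a).toReal = _
  simp

/-- The two utilities agree pointwise, and both lie between 0 and `x`, which makes them integrable.
-/
theorem knowledgeTruthful_csm (n : ℕ) [NeZero n] (D : Fin n → ValueDist)
    (G : Digraph (Fin n)) : KnowledgeTruthful (csm n) D G := by
  intro i x K σ hm1 hm2
  have hself : ∀ L v, knowledgeProfile i x L σ v i = ⟨x, L⟩ := fun L v => if_pos rfl
  have hother : ∀ L L' v j, j ≠ i → knowledgeProfile i x L σ v j = knowledgeProfile i x L' σ v j :=
    fun L L' v j hj => by simp [knowledgeProfile, hj]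
  have hinteg : ∀ L, AEStronglyMeasurable
      (fun v => (csm n).utility i x (knowledgeProfile i x L σ v)) (prior D) →
      Integrable (fun v => (csm n).utility i x (knowledgeProfile i x L σ v)) (prior D) := by
    intro L hL
    refine (integrable_const (∑ _a : Fin n, 1 / (n : ℝ) * (x : ℝ))).mono' hL
      (Eventually.of_forall fun v => ?_)
    refine (norm_sum_le _ _).trans (Finset.sum_le_sum fun a _ => ?_)
    have h : 0 ≤ ((csm n).outcome a (knowledgeProfile i x L σ v)).utility i x ∧
        ((csm n).outcome a (knowledgeProfile i x L σ v)).utility i x ≤ x := by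
      have := utility_mem_Icc a i (knowledgeProfile i x L σ v)
      rwa [hself] at this
    have h0 : (0 : ℝ) ≤ 1 / (n : ℝ) := by positivity
    have hc : ((csm n).coinLaw a).toReal = 1 / (n : ℝ) := coinLaw_csm n a
    rw [hc, Real.norm_of_nonneg (mul_nonneg h0 h.1)]
    exact mul_le_mul_of_nonneg_left h.2 h0
  refine ⟨hinteg _ hm1, hinteg _ hm2, le_of_eq (integral_congr_ae (Eventually.of_forall
    fun v => Finset.sum_congr rfl fun a _ => ?_))⟩
  have := utility_eq_of_value_eq (a := a) (i := i) (hother K (trueKnowledge D G i) v)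
    (by rw [hself, hself])
  rw [hself] at this
  exact congrArg _ this

/-! ### Revenue of threshold sets -/

/-- Tie-breaking only decides whether the superlevel set is weak or strict; below level 0 it plays
no role, since the reserve binds. -/
theorem winSet_cases (d : ValueDist) (R : Finset (Fin n)) (w : Fin n → EReal) (i : Fin n) :
    winSet d R w i = if (∀ j ∈ R, w j = R.sup w → i < j) ∨ R.sup w < 0
      then {x | max (R.sup w) 0 ≤ d.virtualValue x} else {x | R.sup w < d.virtualValue x} := by
  ext x
  rw [mem_winSet_iff]
  split_ifs with h
  · refine ⟨fun hx => hx.1, fun hx => ⟨hx, fun heq => ?_⟩⟩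
    rcases h with h | h
    · exact h
    · exact absurd ((le_max_right _ _).trans hx) (not_le.2 (heq ▸ h))
  · rw [not_or, not_lt] at h
    rw [max_eq_left h.2]
    exact ⟨fun hx => lt_of_le_of_ne hx.1 fun heq => h.1 (hx.2 heq.symm),
      fun hx => ⟨le_of_lt hx, fun heq => absurd heq hx.ne'⟩⟩

/-- The threshold payment extracts the full virtual surplus. -/
theorem sInf_winSet_mul (d : ValueDist) (R : Finset (Fin n)) (w : Fin n → EReal) (i : Fin n) :
    ((sInf (winSet d R w i) : ℝ≥0) : ℝ) * d.law.real (winSet d R w i) =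
      ∫ x in winSet d R w i, (d.posVV x : ℝ) ∂d.law := by
  rw [winSet_cases]
  split_ifs with h
  · have h0 : 0 ≤ max (R.sup w) 0 := le_max_right _ _
    generalize max (R.sup w) 0 = c at *
    induction c with
    | bot => simp at h0
    | top => simp [top_le_iff, d.virtualValue_ne_top]
    | coe c => exact d.mul_real_eq_setIntegral_of_le (by exact_mod_cast h0)
  · rw [not_or, not_lt] at h
    have h0 := h.2
    generalize R.sup w = c at *
    induction c with
    | bot => simp at h0
    | top => simp
    | coe c => exact d.mul_real_eq_setIntegral_of_lt (by exact_mod_cast h0)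

/-- In `ℝ≥0` the infimum of the empty set is 0, which destroys monotonicity; in `ENNReal` it is `⊤`,
and `ENNReal.toNNReal` sends it back to 0. -/
theorem measurable_sInf_of_antitone {A : EReal → Set ℝ≥0} (hA : Antitone A) :
    Measurable fun c => sInf (A c) := by
  have hg : Monotone fun c => ⨅ x ∈ A c, (x : ENNReal) := fun c c' h =>
    biInf_mono (hA h)
  have he : (fun c => sInf (A c)) = fun c => (⨅ x ∈ A c, (x : ENNReal)).toNNReal := by
    funext c
    rcases (A c).eq_empty_or_nonempty with h | h
    · simp [h]
    · rw [← ENNReal.coe_sInf h, ENNReal.toNNReal_coe]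
  rw [he]
  exact ENNReal.measurable_toNNReal.comp hg.measurable

/-! ### The optimal auction with player `a` left out. -/

section Auction

variable (D : Fin n → ValueDist) (a i : Fin n)

/-- The virtual values of the players. -/
def vvals (v : Fin n → ℝ≥0) (j : Fin n) : EReal := (D j).virtualValue (v j)

/-- The values with which `i` wins the optimal auction among all players but `a`. -/
def auctionSet (v : Fin n → ℝ≥0) : Set ℝ≥0 :=
  winSet (D i) ((Finset.univ.erase a).erase i) (vvals D v) i

theorem measurable_vvals (j : Fin n) : Measurable fun v => vvals D v j :=
  (D j).virtualValue_mono.measurable.comp (measurable_pi_apply j)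

theorem auctionSet_update (v : Fin n → ℝ≥0) (b : ℝ≥0) :
    auctionSet D a i (Function.update v i b) = auctionSet D a i v :=
  winSet_congr _ _ fun j hj => by
    rw [vvals, vvals, Function.update_of_ne (Finset.ne_of_mem_erase hj)]

theorem measurable_sInf_auctionSet : Measurable fun v => sInf (auctionSet D a i v) := by
  set R := (Finset.univ.erase a).erase i
  have hw : ∀ j, Measurable fun v => vvals D v j := measurable_vvals D
  have hsup : Measurable fun v => R.sup (vvals D v) :=
    measurable_finset_sup (f := fun j v => vvals D v j) R fun j _ => hw j
  have heq : (fun v => sInf (auctionSet D a i v)) = fun v =>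
      if (∀ j ∈ R, vvals D v j = R.sup (vvals D v) → i < j) ∨ R.sup (vvals D v) < 0
      then sInf {x | max (R.sup (vvals D v)) 0 ≤ (D i).virtualValue x}
      else sInf {x | R.sup (vvals D v) < (D i).virtualValue x} := by
    funext v
    rw [auctionSet, winSet_cases]
    split_ifs <;> rfl
  rw [heq]
  refine Measurable.ite ?_ ?_ ?_
  · refine MeasurableSet.union ?_ (measurableSet_lt hsup measurable_const)
    have : {v | ∀ j ∈ R, vvals D v j = R.sup (vvals D v) → i < j} =
        ⋂ j ∈ R, ({v | vvals D v j = R.sup (vvals D v)}ᶜ ∪ {_v | i < j}) := by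
      ext v
      simp only [Set.mem_iInter, Set.mem_union, Set.mem_compl_iff, Set.mem_ofPred_eq,
        imp_iff_not_or]
    change MeasurableSet {v | ∀ j ∈ R, vvals D v j = R.sup (vvals D v) → i < j}
    rw [this]
    exact Finset.measurableSet_biInter R fun j _ =>
      (measurableSet_eq_fun (hw j) hsup).compl.union (MeasurableSet.const _)
  · exact (measurable_sInf_of_antitone (A := fun c => {x | c ≤ (D i).virtualValue x})
      fun c c' h x hx => h.trans hx).comp (hsup.max measurable_const)
  · exact (measurable_sInf_of_antitone (A := fun c => {x | c < (D i).virtualValue x})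
      fun c c' h x hx => h.trans_lt hx).comp hsup

theorem measurableSet_mem_auctionSet : MeasurableSet {v | v i ∈ auctionSet D a i v} := by
  set R := (Finset.univ.erase a).erase i with hR
  have hw : ∀ j, Measurable fun v => vvals D v j := measurable_vvals D
  have : {v | v i ∈ auctionSet D a i v} = {v | 0 ≤ vvals D v i} ∩
      ⋂ j ∈ R, ({v | vvals D v j < vvals D v i} ∪
        ({v | vvals D v j = vvals D v i} ∩ {_v | i < j})) := by
    ext v
    simp only [Set.mem_inter_iff, Set.mem_iInter, Set.mem_union, auctionSet, winSet,
      Set.mem_ofPred_eq, ← hR]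
    rfl
  rw [this]
  exact (measurableSet_le measurable_const (hw i)).inter (Finset.measurableSet_biInter R
    fun j _ => (measurableSet_lt (hw j) (hw i)).union
      ((measurableSet_eq_fun (hw j) (hw i)).inter (MeasurableSet.const _)))

/-- The payment of `i` in the optimal auction among all players but `a`. -/
def auctionPay (v : Fin n → ℝ≥0) : ℝ :=
  {v | v i ∈ auctionSet D a i v}.indicator (fun v => ((sInf (auctionSet D a i v) : ℝ≥0) : ℝ)) v

/-- The virtual surplus contributed by `i` in the optimal auction among all players but `a`. -/
def auctionSurplus (v : Fin n → ℝ≥0) : ℝ :=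
  {v | v i ∈ auctionSet D a i v}.indicator (fun v => ((D i).posVV (v i) : ℝ)) v

variable {D a i} in
theorem auctionPay_of_mem {v : Fin n → ℝ≥0} (h : v i ∈ auctionSet D a i v) :
    auctionPay D a i v = ((sInf (auctionSet D a i v) : ℝ≥0) : ℝ) :=
  Set.indicator_of_mem (s := {v | v i ∈ auctionSet D a i v}) h _

variable {D a i} in
theorem auctionPay_of_notMem {v : Fin n → ℝ≥0} (h : v i ∉ auctionSet D a i v) :
    auctionPay D a i v = 0 :=
  Set.indicator_of_notMem (s := {v | v i ∈ auctionSet D a i v}) h _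

variable {D a i} in
theorem auctionSurplus_of_mem {v : Fin n → ℝ≥0} (h : v i ∈ auctionSet D a i v) :
    auctionSurplus D a i v = ((D i).posVV (v i) : ℝ) :=
  Set.indicator_of_mem (s := {v | v i ∈ auctionSet D a i v}) h _

variable {D a i} in
theorem auctionSurplus_of_notMem {v : Fin n → ℝ≥0} (h : v i ∉ auctionSet D a i v) :
    auctionSurplus D a i v = 0 :=
  Set.indicator_of_notMem (s := {v | v i ∈ auctionSet D a i v}) h _

theorem integrable_auctionPay : Integrable (auctionPay D a i) (prior D) := by
  refine (integrable_comp_eval D i (D i).finiteMean).mono' ?_ (Eventually.of_forall fun v => ?_)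
  · exact ((measurable_sInf_auctionSet D a i).coe_nnreal_real.indicator
      (measurableSet_mem_auctionSet D a i)).aestronglyMeasurable
  · by_cases hv : v i ∈ auctionSet D a i v
    · rw [auctionPay_of_mem hv, Real.norm_of_nonneg (NNReal.coe_nonneg _)]
      exact sInf_le_of_mem hv
    · rw [auctionPay_of_notMem hv, norm_zero]
      exact NNReal.coe_nonneg _

theorem integrable_auctionSurplus : Integrable (auctionSurplus D a i) (prior D) :=
  (integrable_comp_eval D i (D i).integrable_posVV).indicator (measurableSet_mem_auctionSet D a i)

/-- With the others' values fixed, `i` faces a fixed win set, so `sInf_winSet_mul` applies fibre by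
fibre. -/
theorem integral_auctionPay :
    ∫ v, auctionPay D a i v ∂prior D = ∫ v, auctionSurplus D a i v ∂prior D := by
  have h1 := integrable_auctionPay D a i
  have h2 := integrable_auctionSurplus D a i
  rw [integral_prior_eq_integral_prod i h1, integral_prior_eq_integral_prod i h2,
    integral_prod _ (integrable_update h1), integral_prod _ (integrable_update h2)]
  refine integral_congr_ae (Eventually.of_forall fun v => ?_)
  set W := auctionSet D a i v with hW
  have hm : MeasurableSet W := measurableSet_of_isUpperSet (isUpperSet_winSet _ _ _ _)
  have e1 : (fun b => auctionPay D a i (Function.update v i b)) =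
      W.indicator fun _ => ((sInf W : ℝ≥0) : ℝ) := by
    funext b
    have hb : Function.update v i b i ∈ auctionSet D a i (Function.update v i b) ↔ b ∈ W := by
      rw [auctionSet_update, Function.update_self]
    by_cases h : b ∈ W
    · rw [auctionPay_of_mem (hb.2 h), Set.indicator_of_mem h, auctionSet_update]
    · rw [auctionPay_of_notMem (mt hb.1 h), Set.indicator_of_notMem h]
  have e2 : (fun b => auctionSurplus D a i (Function.update v i b)) =
      W.indicator fun b => ((D i).posVV b : ℝ) := by
    funext b
    have hb : Function.update v i b i ∈ auctionSet D a i (Function.update v i b) ↔ b ∈ W := by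
      rw [auctionSet_update, Function.update_self]
    by_cases h : b ∈ W
    · rw [auctionSurplus_of_mem (hb.2 h), Set.indicator_of_mem h, Function.update_self]
    · rw [auctionSurplus_of_notMem (mt hb.1 h), Set.indicator_of_notMem h]
  simp only [e1, e2]
  rw [integral_indicator hm, integral_indicator hm, setIntegral_const, smul_eq_mul, mul_comm]
  exact sInf_winSet_mul _ _ _ _

variable {D a i}

theorem not_mem_auctionSet {v : Fin n → ℝ≥0} {k : Fin n} (hk : k ≠ a) (hik : i ≠ k)
    (hb : Beats (vvals D v) k i) : v i ∉ auctionSet D a i v := by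
  intro h
  refine hb.asymm (h.2 k ?_)
  exact Finset.mem_erase.2 ⟨hik.symm, Finset.mem_erase.2 ⟨hk, Finset.mem_univ k⟩⟩

variable (D a) in
-- Only the top player can contribute, as he beats the rest; if his virtual value is negative,
-- nobody wins and both sides are 0.
theorem sum_auctionSurplus (v : Fin n → ℝ≥0) :
    ∑ i ∈ Finset.univ.erase a, auctionSurplus D a i v = surplus D (Finset.univ.erase a) v := by
  rcases (Finset.univ.erase a).eq_empty_or_nonempty with he | hne
  · simp [he, surplus]
  set k := top (vvals D v) (Finset.univ.erase a) hne
  have hk : k ∈ Finset.univ.erase a := top_mem _ hne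
  have hka : k ≠ a := Finset.ne_of_mem_erase hk
  have hbeats : ∀ j ∈ Finset.univ.erase a, j ≠ k → Beats (vvals D v) k j := fun j hj hjk =>
    top_beats _ hne hj hjk
  have hle : ∀ j ∈ Finset.univ.erase a, vvals D v j ≤ vvals D v k := fun j hj => by
    rcases eq_or_ne j k with rfl | hjk
    · exact le_rfl
    · exact (hbeats j hj hjk).elim le_of_lt fun h => h.1.le
  have hsur : surplus D (Finset.univ.erase a) v = (D k).posVV (v k) := by
    refine le_antisymm (Finset.sup_le fun j hj => ?_)
      (Finset.le_sup (f := fun j => (D j).posVV (v j)) hk)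
    refine NNReal.coe_le_coe.1 (((D j).posVV_le_iff (NNReal.coe_nonneg _)).2 ?_)
    exact (hle j hj).trans (((D k).posVV_le_iff (NNReal.coe_nonneg _)).1 le_rfl)
  rw [hsur, Finset.sum_eq_single_of_mem k hk]
  · by_cases hpos : 0 ≤ vvals D v k
    · refine auctionSurplus_of_mem ⟨hpos, fun j hj => ?_⟩
      exact hbeats j (Finset.mem_of_mem_erase hj) (Finset.ne_of_mem_erase hj)
    · have h0 : (D k).posVV (v k) ≤ (0 : ℝ) :=
        ((D k).posVV_le_iff le_rfl).2 (not_le.1 hpos).le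
      rw [auctionSurplus_of_notMem fun h => hpos h.1]
      exact le_antisymm (NNReal.coe_nonneg _) h0
  · intro j hj hjk
    exact auctionSurplus_of_notMem (not_mem_auctionSet hka hjk (hbeats j hj hjk))

end Auction

/-! ### The truthful run -/

theorem exists_edge_of_reflTransGen {α : Type*} {r : α → α → Prop} {p : α → Prop}
    {x y : α} (h : Relation.ReflTransGen r x y) (hx : p x) (hy : ¬ p y) :
    ∃ u w, p u ∧ ¬ p w ∧ r u w := by
  induction h with
  | refl => exact absurd hx hy
  | @tail b c _ hbc ih =>
    by_cases hb : p b
    · exact ⟨b, c, hb, hy, hbc⟩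
    · exact ih hb

section Truthful

variable {D : Fin n → ValueDist} {G : Digraph (Fin n)} {v : Fin n → ℝ≥0} {a : Fin n}

theorem trueKnowledge_isSome_iff {i j : Fin n} :
    (trueKnowledge D G i j).isSome = true ↔ G.Adj i j := by
  unfold trueKnowledge
  split_ifs with h <;> simp [h]

theorem eq_of_trueKnowledge_eq_some {i j : Fin n} {d : ValueDist}
    (h : trueKnowledge D G i j = some d) : d = D j := by
  unfold trueKnowledge at h
  split_ifs at h
  exact (Option.some.inj h).symm

theorem mem_initialSet_truthful {j : Fin n} :
    j ∈ initialSet (truthful D G v) a ↔ j ≠ a ∧ G.Adj a j := by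
  unfold initialSet initialDist
  rw [Finset.mem_filter]
  by_cases hj : j = a
  · simp [hj]
  · simp only [Finset.mem_univ, true_and, ne_eq, hj, not_false_eq_true]
    exact trueKnowledge_isSome_iff

theorem mem_discovered_truthful {σ : State n} {j : Fin n} :
    j ∈ discovered (truthful D G v) σ ↔ j ∈ σ.rest ∧ ∃ i ∈ σ.S.erase σ.star, G.Adj i j := by
  unfold discovered
  rw [Finset.mem_filter]
  refine and_congr_right fun _ => exists_congr fun i => and_congr_right fun _ => ?_
  exact trueKnowledge_isSome_iff

theorem firstReport_truthful {σ : State n} {j : Fin n}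
    (hj : j ∈ discovered (truthful D G v) σ) : firstReport (truthful D G v) σ j = some (D j) := by
  obtain ⟨-, i, hi, hij⟩ := mem_discovered_truthful.1 hj
  cases hf : firstReport (truthful D G v) σ j with
  | none =>
    unfold firstReport at hf
    rw [List.findSome?_eq_none_iff] at hf
    have := hf i (List.mem_finRange i)
    rw [if_pos hi] at this
    have hs := trueKnowledge_isSome_iff (D := D).2 hij
    rw [show trueKnowledge D G i j = none from this] at hs
    cases hs
  | some d =>
    obtain ⟨k, -, hk⟩ := List.exists_of_findSome?_eq_some hf
    split_ifs at hk
    rw [eq_of_trueKnowledge_eq_some hk]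

/-- In a truthful run, the collected distributions are the true ones, and the neighbours of the
players who have been dropped are collected. -/
structure Explored (D : Fin n → ValueDist) (G : Digraph (Fin n)) (a : Fin n) (σ : State n) :
    Prop where
  dist : ∀ j, j ∉ σ.rest → j ≠ a → σ.D' j = some (D j)
  closed : ∀ x, x ∉ σ.rest → x ∉ σ.S → ∀ y, G.Adj x y → y ∉ σ.rest

/-- The leader stays in the current set, so a player dropped in this round has just been consulted
and his uncollected neighbours were discovered. -/
theorem Explored.next {σ : State n} (h : Explored D G a σ) :
    Explored D G a (next (truthful D G v) σ) := by
  rw [next_eq]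
  set S' := discovered (truthful D G v) σ with hS'
  refine ⟨fun j hjr hja => ?_, fun x hxr hxS y hxy hyr => ?_⟩
  · change nextDist (truthful D G v) σ j = some (D j)
    by_cases hj : j ∈ S'
    · exact (if_pos hj).trans (firstReport_truthful hj)
    · exact (if_neg hj).trans
        (h.dist j (fun hh => hjr (Finset.mem_sdiff.2 ⟨hh, hj⟩)) hja)
  · have hyr' := Finset.mem_sdiff.1 hyr
    change x ∉ insert σ.star S' at hxS
    rw [Finset.mem_insert, not_or] at hxS
    have hxr' : x ∉ σ.rest := fun hh => hxr (Finset.mem_sdiff.2 ⟨hh, hxS.2⟩)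
    by_cases hx : x ∈ σ.S
    · exact hyr'.2 (mem_discovered_truthful.2
        ⟨hyr'.1, x, Finset.mem_erase.2 ⟨hxS.1, hx⟩, hxy⟩)
    · exact h.closed x hxr' hx y hxy hyr'.1

theorem explored_finalState (hne : (initialSet (truthful D G v) a).Nonempty) :
    Explored D G a (finalState (truthful D G v) a hne) := by
  refine collect_induction (fun σ h _ => h.next) _ ⟨fun j hjr hja => ?_, fun x hxr hxS y hxy hyr => ?_⟩
  · have hj : j ∈ initialSet (truthful D G v) a := by
      by_contra hj
      refine hjr (Finset.mem_sdiff.2 ⟨Finset.mem_univ j, ?_⟩)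
      rw [Finset.mem_union, Finset.mem_singleton, not_or]
      exact ⟨hja, hj⟩
    have hadj := (mem_initialSet_truthful.1 hj).2
    change (if j = a then none else trueKnowledge D G a j) = some (D j)
    rw [if_neg hja, trueKnowledge, if_pos hadj]
  · change y ∈ Finset.univ \ ({a} ∪ initialSet (truthful D G v) a) at hyr
    change x ∉ Finset.univ \ ({a} ∪ initialSet (truthful D G v) a) at hxr
    change x ∉ initialSet (truthful D G v) a at hxS
    simp only [Finset.mem_sdiff, Finset.mem_univ, true_and, Finset.mem_union,
      Finset.mem_singleton, not_or, not_and_or, not_not] at hxr hyr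
    obtain rfl := hxr.resolve_right hxS
    exact hyr.2 (mem_initialSet_truthful.2 ⟨hyr.1, hxy⟩)

/-- On a 2-connected graph, a truthful run collects all distributions. -/
theorem rest_finalState (hG : TwoConnected G)
    (hne : (initialSet (truthful D G v) a).Nonempty) :
    (finalState (truthful D G v) a hne).rest = ∅ := by
  set σ := finalState (truthful D G v) a hne with hσ
  have hwf : WellFormed a (truthful D G v) σ := wellFormed_finalState _ a hne
  have hex : Explored D G a σ := explored_finalState hne
  have hexit : ¬ (discovered (truthful D G v) σ).Nonempty := discovered_collect _ _
  by_contra hr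
  obtain ⟨j, hj⟩ := Finset.nonempty_iff_ne_empty.2 hr
  have ha : a ≠ σ.star := fun h => hwf.notMem (h ▸ hwf.star_mem)
  have hjs : j ≠ σ.star := fun h => hwf.disjoint _ hwf.star_mem (h ▸ hj)
  -- A path from `a` to `j` avoiding the leader has an edge from `u` outside `rest` to `w` in
  -- `rest`. If `u` is in the current set, `w` would be discovered; if `u` was dropped or is `a`,
  -- `w` would have been collected.
  obtain ⟨u, w, hu, hw, huw⟩ := exists_edge_of_reflTransGen
    (p := fun x : {x // x ≠ σ.star} => x.1 ∉ σ.rest)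
    (hG.2 σ.star ⟨a, ha⟩ ⟨j, hjs⟩) hwf.notMem_rest (not_not.2 hj)
  have hw' : w.1 ∈ σ.rest := not_not.1 hw
  by_cases huS : u.1 ∈ σ.S
  · exact hexit ⟨w.1, mem_discovered_truthful.2
      ⟨hw', u.1, Finset.mem_erase.2 ⟨u.2, huS⟩, huw⟩⟩
  · exact hex.closed u.1 hu huS w.1 huw hw'

/-- On a 2-connected graph, a truthful run is the optimal auction without player `a`. -/
theorem price_truthful (hG : TwoConnected G) (i : Fin n) :
    (csmOutcome a (truthful D G v)).price i = if i = a then 0 else auctionPay D a i v := by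
  by_cases hne : (initialSet (truthful D G v) a).Nonempty
  · rw [csmOutcome_eq hne]
    have hwf := wellFormed_finalState (truthful D G v) a hne
    have hex := explored_finalState hne
    have hrest := rest_finalState hG hne
    set σ := finalState (truthful D G v) a hne with hσ
    have hdist : ∀ j, j ≠ a → σ.D' j = some (D j) := fun j hj =>
      hex.dist j (by rw [hrest]; exact Finset.notMem_empty j) hj
    have hstar : σ.star ≠ a := fun h => hwf.notMem (h ▸ hwf.star_mem)
    have hscore : ∀ j, j ≠ a → score (truthful D G v) σ.D' j = vvals D v j := fun j hj =>
      score_eq_of_some (hdist j hj)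
    have hloser : ∀ j, j ≠ a → j ≠ σ.star → auctionPay D a j v = 0 := fun j hj hjs =>
      auctionPay_of_notMem (not_mem_auctionSet hstar hjs
        ((hwf.beats j (by rw [hrest]; exact Finset.notMem_empty j) hj hjs).congr
          (hscore _ hstar) (hscore j hj)))
    have hset : winSet (D σ.star) (rivals a σ) (score (truthful D G v) σ.D') σ.star =
        auctionSet D a σ.star v := by
      have hR : rivals a σ = (Finset.univ.erase a).erase σ.star := by
        ext j
        rw [WellFormed.mem_rivals, hrest]
        simp [and_comm]
      rw [auctionSet, ← hR]
      exact winSet_congr _ _ fun j hj => hscore j (WellFormed.mem_rivals.1 hj).2.1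
    rcases finish_cases (truthful D G v) a σ with ⟨h, hneg⟩ | ⟨d, hd, h0, h⟩
    · rw [h]
      change (0 : ℝ) = _
      split_ifs with hia
      · rfl
      rcases eq_or_ne i σ.star with rfl | his
      · exact (auctionPay_of_notMem
          fun hh => absurd hh.1 (not_le.2 (hneg _ (hdist _ hstar)))).symm
      · exact (hloser i hia his).symm
    · obtain rfl : D σ.star = d := Option.some.inj ((hdist _ hstar).symm.trans hd)
      have hmem := hwf.mem_winSet hd h0
      rw [h, hset] at *
      change (Pi.single σ.star _ : Fin n → ℝ) i = _
      rcases eq_or_ne i σ.star with rfl | his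
      · rw [if_neg hstar, Pi.single_eq_same]
        exact (auctionPay_of_mem hmem).symm
      · rw [Pi.single_eq_of_ne his]
        split_ifs with hia
        · rfl
        · exact (hloser i hia his).symm
  -- Strong connectivity gives `a` an out-neighbour unless `a` is the only player.
  · have hia : i = a := by
      by_contra hia
      obtain ⟨u, w, rfl, hw, huw⟩ := exists_edge_of_reflTransGen (p := fun x => x = a)
        (hG.1 a i) rfl hia
      exact hne ⟨w, mem_initialSet_truthful.2 ⟨hw, huw⟩⟩
    rw [if_pos hia]
    unfold csmOutcome
    rw [dif_neg hne]
    rfl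

end Truthful

/-! ### Revenue of the truthful run compared with the optimum. -/

theorem csm_revenue_truthful [NeZero n] (D : Fin n → ValueDist) {G : Digraph (Fin n)}
    (hG : TwoConnected G) (v : Fin n → ℝ≥0) :
    (csm n).revenue (truthful D G v) =
      ∑ a, 1 / (n : ℝ) * ∑ i ∈ Finset.univ.erase a, auctionPay D a i v := by
  change ∑ a : Fin n, ((csm n).coinLaw a).toReal *
    ∑ i, ((csm n).outcome a (truthful D G v)).price i = _
  refine Finset.sum_congr rfl fun a _ => ?_
  have hc : ((csm n).coinLaw a).toReal = 1 / (n : ℝ) := coinLaw_csm n a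
  have hp : ∀ i, ((csm n).outcome a (truthful D G v)).price i =
      if i = a then 0 else auctionPay D a i v := price_truthful hG
  simp only [hc, hp]
  congr 1
  rw [← Finset.sum_erase_add _ _ (Finset.mem_univ a), if_pos rfl, add_zero]
  exact Finset.sum_congr rfl fun i hi => if_neg (Finset.ne_of_mem_erase hi)

/-- Leaving out a uniformly random player costs at most a fraction `1 / n` of the surplus. -/
theorem mul_surplus_le [NeZero n] (D : Fin n → ValueDist) (v : Fin n → ℝ≥0) :
    (1 - 1 / (n : ℝ)) * surplus D Finset.univ v ≤
      ∑ a, 1 / (n : ℝ) * (surplus D (Finset.univ.erase a) v : ℝ) := by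
  -- Excluding any of the `n - 1` players other than a maximizer `k` leaves the surplus intact.
  obtain ⟨k, -, hk⟩ := Finset.exists_mem_eq_sup Finset.univ Finset.univ_nonempty
    fun j => (D j).posVV (v j)
  have hn : (0 : ℝ) < n := Nat.cast_pos.2 (NeZero.pos n)
  have hn1 : 1 ≤ n := NeZero.one_le
  calc (1 - 1 / (n : ℝ)) * surplus D Finset.univ v
      = ∑ _a ∈ Finset.univ.erase k, 1 / (n : ℝ) * (surplus D Finset.univ v : ℝ) := by
        rw [Finset.sum_const, Finset.card_erase_of_mem (Finset.mem_univ k), Finset.card_fin,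
          nsmul_eq_mul, Nat.cast_sub hn1]
        field_simp
        ring
    _ ≤ ∑ a ∈ Finset.univ.erase k, 1 / (n : ℝ) * (surplus D (Finset.univ.erase a) v : ℝ) := by
        refine Finset.sum_le_sum fun a ha => mul_le_mul_of_nonneg_left ?_ (by positivity)
        refine NNReal.coe_le_coe.2 ?_
        rw [show surplus D Finset.univ v = (D k).posVV (v k) from hk]
        exact Finset.le_sup (f := fun j => (D j).posVV (v j))
          (Finset.mem_erase.2 ⟨(Finset.ne_of_mem_erase ha).symm, Finset.mem_univ k⟩)
    _ ≤ _ := Finset.sum_le_sum_of_subset_of_nonneg (Finset.erase_subset _ _) fun a _ _ =>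
        mul_nonneg (by positivity) (NNReal.coe_nonneg _)

end CrowdAuction

end

theorem theorem5 (n : ℕ) [NeZero n] (D : Fin n → CrowdAuction.ValueDist)
    (G : Digraph (Fin n)) (hG : CrowdAuction.TwoConnected G) :
    CrowdAuction.TwoDST (CrowdAuction.csm n) D G ∧
    MeasureTheory.Integrable
      (fun v => (CrowdAuction.csm n).revenue (CrowdAuction.truthful D G v))
      (CrowdAuction.prior D) ∧
    ((1 - 1 / (n : ℝ) : ℝ) : EReal) * CrowdAuction.OPT D ≤
      ((∫ v, (CrowdAuction.csm n).revenue (CrowdAuction.truthful D G v)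
        ∂(CrowdAuction.prior D) : ℝ) : EReal) := by
  open CrowdAuction MeasureTheory in
  have hpay : ∀ a, ∀ i ∈ Finset.univ.erase a, Integrable (auctionPay D a i) (prior D) :=
    fun a i _ => integrable_auctionPay D a i
  have hsum : ∀ a ∈ Finset.univ, Integrable
      (fun v => 1 / (n : ℝ) * ∑ i ∈ Finset.univ.erase a, auctionPay D a i v) (prior D) :=
    fun a _ => (integrable_finsetSum _ (hpay a)).const_mul _
  have hsur : ∀ a ∈ Finset.univ, Integrable
      (fun v => 1 / (n : ℝ) * (surplus D (Finset.univ.erase a) v : ℝ)) (prior D) :=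
    fun a _ => (integrable_surplus D _).const_mul _
  have hrev : ∀ v, (csm n).revenue (truthful D G v) = _ := csm_revenue_truthful D hG
  have hreveq : ∫ v, (csm n).revenue (truthful D G v) ∂prior D =
      ∫ v, ∑ a, 1 / (n : ℝ) * (surplus D (Finset.univ.erase a) v : ℝ) ∂prior D := by
    simp only [hrev]
    rw [integral_finsetSum _ hsum, integral_finsetSum _ hsur]
    refine Finset.sum_congr rfl fun a _ => ?_
    rw [integral_const_mul, integral_const_mul, integral_finsetSum _ (hpay a)]
    simp only [integral_auctionPay]
    rw [← integral_finsetSum _ fun i _ => integrable_auctionSurplus D a i]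
    simp only [sum_auctionSurplus]
  refine ⟨⟨valueTruthful_csm n, knowledgeTruthful_csm n D G⟩, ?_, ?_⟩
  · simp only [hrev]
    exact integrable_finsetSum _ hsum
  · have hfac : (0 : ℝ) ≤ 1 - 1 / (n : ℝ) := by
      have : (1 : ℝ) ≤ n := Nat.one_le_cast.2 NeZero.one_le
      exact sub_nonneg.2 (div_le_one_of_le₀ this (Nat.cast_nonneg n))
    refine (mul_le_mul_of_nonneg_left (OPT_le D) (EReal.coe_nonneg.2 hfac)).trans ?_
    rw [← EReal.coe_mul, EReal.coe_le_coe_iff, hreveq, ← integral_const_mul]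
    exact integral_mono ((integrable_surplus D _).const_mul _) (integrable_finsetSum _ hsur)
      fun v => mul_surplus_le D v
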